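/- For real $x>1$ let $$F(x)=\sum_\rho \frac{x^\rho}{\rho(1-\rho)},\qquad S(x)=F(x)-\gamma x+\log 2\pi ,$$ where $\rho$ runs over the non-trivial zeros of the Riemann zeta function (the zeros with $0<\Re\rho<1$), counted with multiplicity, and $\gamma$ is Euler's constant. An \emph{extended Baker period} is an element of the $\overline{\mathbb Q}$-vector subspace of $\mathbb C$ generated by $1$ and the logarithms of non-zero algebraic numbers, where $\overline{\mathbb Q}$ is the field of algebraic numbers in $\mathbb C$. Theorem (without assuming the Riemann hypothesis). (1) The series $F(x)$ converges absolutely for every real $x>1$, and for every real algebraic $x>1$ the number $S(x)$ is an extended Baker period. (2) Assume Schanuel's conjecture: whenever $\alpha_1,\dots,\alpha_n\in\mathbb C$ are linearly independent over $\mathbb Q$, the field $\mathbb Q(\alpha_1,\dots,\alpha_n,e^{\alpha_1},\dots,e^{\alpha_n})$ has transcendence degree at least $n$ over $\mathbb Q$. Then the set $$\{F(x) : x>1,\ x\in\overline{\mathbb Q}\cap\mathbb R\}$$ contains at most one algebraic number. -/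

import Mathlib

/-- The set of non-trivial zeros of the Riemann zeta function: its zeros in the open critical
strip `0 < Re s < 1`. -/
def nontrivialZetaZeros : Set ℂ :=
  {s : ℂ | 0 < s.re ∧ s.re < 1 ∧ riemannZeta s = 0}

/-- The contribution `x ^ ρ / (ρ (1 - ρ))` of a non-trivial zero `ρ`, counted with its
multiplicity (the order of vanishing of zeta at `ρ`). -/
noncomputable def zeroSumTerm (x : ℝ) (ρ : nontrivialZetaZeros) : ℂ :=
  (analyticOrderNatAt riemannZeta (ρ : ℂ) : ℂ) *
    ((x : ℂ) ^ (ρ : ℂ) / ((ρ : ℂ) * (1 - (ρ : ℂ))))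

/-- The sum of `x ^ ρ / (ρ (1 - ρ))` over the non-trivial zeros `ρ` of zeta, counted with
multiplicity. -/
noncomputable def zeroSum (x : ℝ) : ℂ :=
  ∑' ρ : nontrivialZetaZeros, zeroSumTerm x ρ

/-- `S(x)`, the above sum minus `γ x` plus `log 2π`, where `γ` is Euler's constant. -/
noncomputable def zeroSumS (x : ℝ) : ℂ :=
  zeroSum x - (Real.eulerMascheroniConstant : ℂ) * (x : ℂ) + (Real.log (2 * Real.pi) : ℂ)

/-- Extended Baker periods: the vector space over the field of algebraic numbers in `ℂ` generated
by `1` and all logarithms `l` (all determinations) of non-zero algebraic numbers `exp l`. -/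
noncomputable def extendedBakerPeriods : Submodule (algebraicClosure ℚ ℂ) ℂ :=
  Submodule.span (algebraicClosure ℚ ℂ) ({1} ∪ {l : ℂ | IsAlgebraic ℚ (Complex.exp l)})

/-- Schanuel's conjecture. -/
def SchanuelConjecture : Prop :=
  ∀ (n : ℕ) (α : Fin n → ℂ), LinearIndependent ℚ α →
    (n : Cardinal) ≤ Algebra.trdeg ℚ
      (IntermediateField.adjoin ℚ (Set.range α ∪ Set.range (fun i => Complex.exp (α i))))

/-! Everything rests on an explicit formula for `x > 1`: `F(x)` equals `∑ Λ(n) max(x/n - 1, 0) - x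
log x + (γ + 1) x - log 2π + ∑ x^(-2k) / (2k (2k+1))`, the last sum running over `k ≥ 1`
(`zeroSum_eq`). The prime sum is finite and the sum over trivial zeros is elementary
(`trivialZeroSum_eq`). Hence in `S(x)` the terms `γ x` and `log 2π` disappear, and for algebraic `x`
only algebraic combinations of `1` and of logarithms of algebraic numbers remain.

The formula is proved by comparing the transforms `∫₁^∞ x^(-s-1) f(x) dx` of both sides on `Re s =
2`. Both sides are continuous, so Mellin inversion yields pointwise equality without any contour
shift (`eq_zero_of_hasMellinIoi_zero`). The zero side is `∑ m(ρ) / (ρ (1 - ρ) (s - ρ))`, which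
partial fractions reduce to the expansion of `ξ'/ξ` at `s` and at `1`; the other side comes from
`ζ'/ζ`, the digamma series and the value `Λ₀(0)` (`hasSum_zeros_div`).

The expansion of `ξ'/ξ` needs only growth of order at most `3/2`, not a Hadamard product. Dividing
out the zeros in a disc of radius `R` leaves a zero-free function whose logarithmic derivative
varies by `O(R^(-1/2))` between `0` and a fixed `s`, by Borel–Carathéodory
(`Differentiable.hasSum_logDeriv_sub`). It also gives the absolute convergence of `F`.

For part (2), if `F` is algebraic at `x ≠ y`, then `y S(x) - x S(y)` is free of `γ` and exhibits
`log π` as an extended Baker period. Schanuel's conjecture forbids this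
(`SchanuelConjecture.log_pi_notMem`): `log π` and `π` would both be algebraic over the field
generated by `n` independent logarithms of algebraic numbers including `πi` in their span, leaving
no room for `n + 1` independent numbers. -/

section

open Filter Topology Metric

/-! ### Zeros of entire functions of order less than two -/

/-- An entire function is the product of a power of `z - ρ` and an entire function not vanishing
at `ρ`. -/
lemma Differentiable.exists_eq_sub_pow_mul {g : ℂ → ℂ} (hg : Differentiable ℂ g) {ρ : ℂ}
    (hρ : analyticOrderAt g ρ ≠ ⊤) :
    ∃ h : ℂ → ℂ, Differentiable ℂ h ∧ h ρ ≠ 0 ∧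
      ∀ z, g z = (z - ρ) ^ analyticOrderNatAt g ρ * h z := by
  obtain ⟨k, hk, hk0, hgk⟩ := (hg.analyticAt ρ).analyticOrderAt_ne_top.1 hρ
  set m := analyticOrderNatAt g ρ
  set h : ℂ → ℂ := Function.update (fun z ↦ g z / (z - ρ) ^ m) ρ (k ρ) with hh
  have hne : ∀ z, z ≠ ρ → h z = g z / (z - ρ) ^ m := fun z hz ↦ by simp [hh, hz]
  have hhρ : h ρ = k ρ := by simp [hh]
  have hpow : ∀ z, z ≠ ρ → (z - ρ) ^ m ≠ 0 := fun z hz ↦ pow_ne_zero _ (sub_ne_zero.2 hz)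
  refine ⟨h, fun z ↦ ?_, hhρ ▸ hk0, fun z ↦ ?_⟩
  · by_cases hz : z = ρ
    · subst hz
      refine hk.differentiableAt.congr_of_eventuallyEq ?_
      filter_upwards [hgk] with w hw
      by_cases hwz : w = z
      · rw [hwz, hhρ]
      · rw [hne w hwz, hw, smul_eq_mul, mul_div_cancel_left₀ _ (hpow w hwz)]
    · have : DifferentiableAt ℂ (fun z ↦ g z / (z - ρ) ^ m) z :=
        (hg z).div (by fun_prop) (hpow z hz)
      refine this.congr_of_eventuallyEq ?_
      filter_upwards [isOpen_ne.mem_nhds hz] with w hw using hne w hw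
  · by_cases hz : z = ρ
    · rw [hz, hhρ]
      simpa using hgk.self_of_nhds
    · rw [hne z hz, mul_div_cancel₀ _ (hpow z hz)]

/-- An entire function not vanishing at `0` is the product of the factors `(1 - z / ρ) ^ m` over
a finite set of points `ρ ≠ 0` and an entire function not vanishing on that set. -/
lemma Differentiable.exists_eq_prod_mul {f : ℂ → ℂ} (hf : Differentiable ℂ f) (hf0 : f 0 ≠ 0)
    (Z : Finset ℂ) (hZ : ∀ ρ ∈ Z, ρ ≠ 0) :
    ∃ g : ℂ → ℂ, Differentiable ℂ g ∧ (∀ ρ ∈ Z, g ρ ≠ 0) ∧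
      ∀ z, f z = (∏ ρ ∈ Z, (1 - z / ρ) ^ analyticOrderNatAt f ρ) * g z := by
  classical
  induction Z using Finset.induction_on with
  | empty => exact ⟨f, hf, by simp, by simp⟩
  | insert ρ Z hρZ ih =>
    obtain ⟨g, hg, hgZ, hfg⟩ := ih fun σ hσ ↦ hZ σ (Finset.mem_insert_of_mem hσ)
    have hρ0 : ρ ≠ 0 := hZ ρ (Finset.mem_insert_self _ _)
    set P : ℂ → ℂ := fun z ↦ ∏ σ ∈ Z, (1 - z / σ) ^ analyticOrderNatAt f σ with hP
    have hPd : Differentiable ℂ P := by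
      simp only [hP]; fun_prop
    have hPρ : P ρ ≠ 0 := by
      refine Finset.prod_ne_zero_iff.2 fun σ hσ ↦ pow_ne_zero _ ?_
      have hσ0 : σ ≠ 0 := hZ σ (Finset.mem_insert_of_mem hσ)
      rw [sub_ne_zero, ne_comm, Ne, div_eq_one_iff_eq hσ0]
      rintro rfl
      exact hρZ hσ
    have hfeq : f = P * g := funext hfg
    have hgtop : analyticOrderAt g ρ ≠ ⊤ := by
      intro htop
      have := (AnalyticOnNhd.eq_of_eventuallyEq (f := g) (g := 0)
        (fun z _ ↦ hg.analyticAt z) (fun z _ ↦ analyticAt_const)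
        (analyticOrderAt_eq_top.1 htop))
      exact hf0 (by rw [hfg, this]; simp)
    -- The factors already removed do not vanish at the new point, so the multiplicity there is
    -- unchanged.
    have hord : analyticOrderNatAt f ρ = analyticOrderNatAt g ρ := by
      have h0 : analyticOrderAt P ρ = 0 := (hPd.analyticAt ρ).analyticOrderAt_eq_zero.2 hPρ
      have : analyticOrderAt f ρ = analyticOrderAt g ρ := by
        conv_lhs => rw [hfeq]
        rw [analyticOrderAt_mul (hPd.analyticAt ρ) (hg.analyticAt ρ), h0, zero_add]
      rw [analyticOrderNatAt, this, analyticOrderNatAt]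
    obtain ⟨h, hh, hhρ, hgh⟩ := hg.exists_eq_sub_pow_mul hgtop
    set m := analyticOrderNatAt g ρ
    refine ⟨fun z ↦ (-ρ) ^ m * h z, by fun_prop, fun σ hσ ↦ ?_, fun z ↦ ?_⟩
    · refine mul_ne_zero (pow_ne_zero _ (neg_ne_zero.2 hρ0)) ?_
      rcases Finset.mem_insert.1 hσ with rfl | hσ
      · exact hhρ
      · exact fun h0 ↦ hgZ σ hσ (by rw [hgh, h0, mul_zero])
    · rw [Finset.prod_insert hρZ, hfg, hgh, hord]
      have : (z - ρ) = (1 - z / ρ) * (-ρ) := by field_simp; ring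
      rw [this, mul_pow]
      ring

/-- If `g` is entire, nonvanishing on the ball of radius `R` with `g 0 = 1` and
`‖g‖ ≤ exp M` there, then `g' / g` is nearly constant near `0`. -/
lemma norm_logDeriv_sub_le_of_norm_le_exp {g : ℂ → ℂ} (hg : Differentiable ℂ g) {R M : ℝ}
    (hR : 0 < R) (hM : 0 < M) (hg0 : g 0 = 1) (hne : ∀ z ∈ ball (0 : ℂ) R, g z ≠ 0)
    (hgM : ∀ z ∈ ball (0 : ℂ) R, ‖g z‖ ≤ Real.exp M) {s : ℂ} (hs : ‖s‖ < R / 8) :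
    ‖logDeriv g s - logDeriv g 0‖ ≤ 64 * M / R ^ 2 * ‖s‖ := by
  have hLd : DifferentiableOn ℂ (logDeriv g) (ball 0 R) := by
    have h1 : DifferentiableOn ℂ (deriv g) (ball 0 R) :=
      hg.contDiff.differentiable_deriv_two.differentiableOn
    exact h1.div hg.differentiableOn hne
  -- A primitive of `g' / g`, normalised to vanish at `0`, is a holomorphic logarithm of `g` on the
  -- ball.
  obtain ⟨k, hk⟩ := hLd.isExactOn_ball
  have h0R : (0 : ℂ) ∈ ball (0 : ℂ) R := mem_ball_self hR
  set h : ℂ → ℂ := fun z ↦ k z - k 0 with hh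
  have hhd : ∀ z ∈ ball (0 : ℂ) R, HasDerivAt h (logDeriv g z) z := fun z hz ↦
    (hk z hz).sub_const _
  have hexp : ∀ z ∈ ball (0 : ℂ) R, g z = Complex.exp (h z) := by
    have hd : ∀ z ∈ ball (0 : ℂ) R, HasDerivAt (fun z ↦ g z * Complex.exp (-h z)) 0 z := by
      intro z hz
      refine ((hg z).hasDerivAt.fun_mul ((hhd z hz).fun_neg.cexp)).congr_deriv ?_
      rw [logDeriv_apply]
      field_simp [hne z hz]
      ring
    intro z hz
    have := (convex_ball (0 : ℂ) R).is_const_of_fderivWithin_eq_zero (𝕜 := ℂ)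
      (f := fun z ↦ g z * Complex.exp (-h z))
      (fun z hz ↦ (hd z hz).differentiableAt.differentiableWithinAt)
      (fun z hz ↦ by
        rw [fderivWithin_of_isOpen isOpen_ball hz]
        ext
        simpa using (hd z hz).deriv) hz h0R
    have h00 : h 0 = 0 := by simp [hh]
    simp only [hg0, h00, neg_zero, Complex.exp_zero, mul_one] at this
    rw [Complex.exp_neg, mul_inv_eq_one₀ (Complex.exp_ne_zero _)] at this
    exact this
  have hre : Set.MapsTo h (ball 0 R) {z | z.re ≤ M} := by
    intro z hz
    have := hgM z hz
    rw [hexp z hz, Complex.norm_exp] at this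
    exact Real.exp_le_exp.1 this
  -- Borel–Carathéodory: `2 M r / (R - r) ≤ 2 M` for `r ≤ R / 2`.
  have hb : ∀ z ∈ closedBall (0 : ℂ) (R / 2), ‖h z‖ ≤ 2 * M := by
    intro z hz
    rw [mem_closedBall_zero_iff] at hz
    have hz' : z ∈ ball (0 : ℂ) R := by rw [mem_ball_zero_iff]; linarith
    refine (Complex.borelCaratheodory_zero hM
      (fun z hz ↦ (hhd z hz).differentiableAt.differentiableWithinAt) hre hR hz'
      (by simp [hh])).trans ?_
    rw [div_le_iff₀ (by linarith)]
    nlinarith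
  have hsub : ∀ {z : ℂ} {r : ℝ}, 0 ≤ r → ‖z‖ + r < R → closedBall z r ⊆ ball 0 R := by
    intro z r hr hzr w hw
    rw [mem_closedBall, dist_eq_norm] at hw
    rw [mem_ball_zero_iff]
    calc ‖w‖ = ‖(w - z) + z‖ := by simp
      _ ≤ _ := norm_add_le _ _
      _ < R := by linarith
  -- Two Cauchy estimates follow, with radii `R / 4` and `R / 8`; they turn `2 M` into `8 M / R` and
  -- then `64 M / R ^ 2`.
  have hb1 : ∀ z ∈ closedBall (0 : ℂ) (R / 4), ‖logDeriv g z‖ ≤ 8 * M / R := by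
    intro z hz
    rw [mem_closedBall_zero_iff] at hz
    have h1 : DiffContOnCl ℂ h (ball z (R / 4)) := by
      refine DifferentiableOn.diffContOnCl fun w hw ↦ ?_
      rw [closure_ball z (by positivity)] at hw
      exact (hhd w (hsub (by positivity) (by linarith) hw)).differentiableAt.differentiableWithinAt
    have h2 := Complex.norm_deriv_le_of_forall_mem_sphere_norm_le (by positivity) h1
      (C := 2 * M) fun w hw ↦ hb w ?_
    · rw [(hhd z (by rw [mem_ball_zero_iff]; linarith)).deriv] at h2
      refine h2.trans_eq ?_
      field_simp; norm_num
    · rw [mem_sphere, dist_eq_norm] at hw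
      rw [mem_closedBall_zero_iff]
      calc ‖w‖ = ‖(w - z) + z‖ := by simp
        _ ≤ _ := norm_add_le _ _
        _ ≤ R / 2 := by linarith
  have hb2 : ∀ z ∈ ball (0 : ℂ) (R / 8), ‖deriv (logDeriv g) z‖ ≤ 64 * M / R ^ 2 := by
    intro z hz
    rw [mem_ball_zero_iff] at hz
    have h1 : DiffContOnCl ℂ (logDeriv g) (ball z (R / 8)) := by
      refine DifferentiableOn.diffContOnCl (hLd.mono ?_)
      rw [closure_ball z (by positivity)]
      exact hsub (by positivity) (by linarith)
    have h2 := Complex.norm_deriv_le_of_forall_mem_sphere_norm_le (by positivity) h1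
      (C := 8 * M / R) fun w hw ↦ hb1 w ?_
    · refine h2.trans_eq ?_
      field_simp; norm_num
    · rw [mem_sphere, dist_eq_norm] at hw
      rw [mem_closedBall_zero_iff]
      calc ‖w‖ = ‖(w - z) + z‖ := by simp
        _ ≤ _ := norm_add_le _ _
        _ ≤ R / 4 := by linarith
  have := (convex_ball (0 : ℂ) (R / 8)).norm_image_sub_le_of_norm_deriv_le (𝕜 := ℂ)
    (f := logDeriv g) (C := 64 * M / R ^ 2)
    (fun z hz ↦ (hLd.mono (ball_subset_ball (by linarith)) z hz).differentiableAt
      (isOpen_ball.mem_nhds hz)) hb2 (mem_ball_self (by positivity))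
    (mem_ball_zero_iff.2 hs)
  simpa using this

end

/-! ### Counting zeros, and partial fractions of the logarithmic derivative. -/

section

open Filter Topology Metric

/-- The zeros of an entire function, not identically zero, in a closed ball form a finite set. -/
lemma Differentiable.finite_zeros_closedBall {f : ℂ → ℂ} (hf : Differentiable ℂ f)
    (hf0 : f 0 ≠ 0) (R : ℝ) : {z | ‖z‖ ≤ R ∧ f z = 0}.Finite := by
  have h1 := AnalyticOnNhd.preimage_zero_mem_codiscrete (fun z _ ↦ hf.analyticAt z) hf0
  have h2 := mem_codiscrete'.1 h1
  have h3 : {z | ‖z‖ ≤ R ∧ f z = 0} = closedBall (0 : ℂ) R ∩ f ⁻¹' {0} := by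
    ext z; simp
  rw [h3]
  have hcl : IsClosed (f ⁻¹' {0}) := isClosed_singleton.preimage hf.continuous
  refine ((isCompact_closedBall _ _).inter_right hcl).finite ?_
  have hd : IsDiscrete (f ⁻¹' {0}) := by simpa using h2.2
  exact hd.mono Set.inter_subset_right

/-- The finite set of zeros of an entire function in a closed ball around `0`. -/
noncomputable def Differentiable.zerosIn {f : ℂ → ℂ} (hf : Differentiable ℂ f) (hf0 : f 0 ≠ 0)
    (R : ℝ) : Finset ℂ :=
  (hf.finite_zeros_closedBall hf0 R).toFinset

lemma Differentiable.mem_zerosIn {f : ℂ → ℂ} (hf : Differentiable ℂ f) (hf0 : f 0 ≠ 0)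
    {R : ℝ} {z : ℂ} : z ∈ hf.zerosIn hf0 R ↔ ‖z‖ ≤ R ∧ f z = 0 := by
  simp [Differentiable.zerosIn]

/-- Division of an entire function by its zeros in a ball, with a bound for the quotient from the
maximum principle. -/
lemma Differentiable.exists_zerosIn_factorization {f : ℂ → ℂ} (hf : Differentiable ℂ f)
    (hf0 : f 0 = 1) {R B : ℝ} (hR : 0 < R) (hB : ∀ z, ‖z‖ = 4 * R → ‖f z‖ ≤ B) :
    ∃ g : ℂ → ℂ, Differentiable ℂ g ∧ g 0 = 1 ∧ (∀ z, ‖z‖ ≤ R → g z ≠ 0) ∧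
      (∀ z, f z =
        (∏ ρ ∈ hf.zerosIn (by simp [hf0]) R, (1 - z / ρ) ^ analyticOrderNatAt f ρ) * g z) ∧
      ∀ z, ‖z‖ ≤ 4 * R →
        ‖g z‖ * 3 ^ (∑ ρ ∈ hf.zerosIn (by simp [hf0]) R, analyticOrderNatAt f ρ) ≤ B := by
  have hf0' : f 0 ≠ 0 := by simp [hf0]
  set Z := hf.zerosIn hf0' R
  have hZ0 : ∀ ρ ∈ Z, ρ ≠ 0 := by
    rintro ρ hρ rfl
    exact hf0' ((hf.mem_zerosIn hf0').1 hρ).2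
  obtain ⟨g, hg, hgZ, hfg⟩ := hf.exists_eq_prod_mul hf0' Z hZ0
  refine ⟨g, hg, ?_, fun z hz hgz ↦ ?_, hfg, ?_⟩
  · simpa [hf0] using (hfg 0).symm
  · exact hgZ z ((hf.mem_zerosIn hf0').2 ⟨hz, by rw [hfg, hgz, mul_zero]⟩) hgz
  · set N := ∑ ρ ∈ Z, analyticOrderNatAt f ρ
    have hfr : ∀ z ∈ frontier (ball (0 : ℂ) (4 * R)), ‖g z‖ ≤ B / 3 ^ N := by
      intro z hz
      rw [frontier_ball _ (by positivity), mem_sphere_zero_iff_norm] at hz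
      rw [le_div_iff₀ (by positivity)]
      refine le_trans ?_ (hB z hz)
      rw [hfg z, norm_mul, mul_comm]
      refine mul_le_mul_of_nonneg_right ?_ (norm_nonneg _)
      rw [norm_prod, ← Finset.prod_pow_eq_pow_sum]
      refine Finset.prod_le_prod (fun _ _ ↦ by positivity) fun ρ hρ ↦ ?_
      rw [norm_pow]
      refine pow_le_pow_left₀ (by norm_num) ?_ _
      have hρR := ((hf.mem_zerosIn hf0').1 hρ).1
      -- On the circle of radius `4 R` each removed factor has modulus at least `4 - 1 = 3`.
      have h4 : 4 ≤ ‖z / ρ‖ := by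
        rw [norm_div, hz, le_div_iff₀ (norm_pos_iff.2 (hZ0 ρ hρ))]
        linarith
      have := norm_sub_norm_le (z / ρ) 1
      rw [norm_sub_rev, norm_one] at this
      linarith
    intro z hz
    rw [← le_div_iff₀ (by positivity)]
    refine Complex.norm_le_of_forall_mem_frontier_norm_le isBounded_ball
      hg.diffContOnCl hfr ?_
    rw [closure_ball _ (by positivity), mem_closedBall_zero_iff]
    exact hz

section GrowthOrder

variable {f : ℂ → ℂ} {C : ℝ}

/-- An entire function of order at most `3 / 2` has `O(R ^ (3 / 2))` zeros in the disk of
radius `R`. -/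
lemma Differentiable.sum_order_zerosIn_le (hf : Differentiable ℂ f) (hf0 : f 0 = 1)
    (hfC : ∀ z, ‖f z‖ ≤ Real.exp (C * (1 + ‖z‖) ^ (3 / 2 : ℝ))) {R : ℝ} (hR : 0 < R) :
    ∑ ρ ∈ hf.zerosIn (by simp [hf0]) R, (analyticOrderNatAt f ρ : ℝ) ≤
      C * (1 + 4 * R) ^ (3 / 2 : ℝ) := by
  obtain ⟨g, -, hg0, -, -, hgB⟩ := hf.exists_zerosIn_factorization hf0 hR
    (B := Real.exp (C * (1 + 4 * R) ^ (3 / 2 : ℝ))) fun z hz ↦ hz ▸ hfC z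
  -- At the centre the quotient is `1`, so `3 ^ N` is below the bound for `f`, and `log 3 ≥ 1` gives
  -- the count `N`. This replaces Jensen's formula.
  have h := hgB 0 (by rw [norm_zero]; positivity)
  rw [hg0, norm_one, one_mul] at h
  have h2 := Real.log_le_log (by positivity) h
  rw [Real.log_exp, Real.log_pow] at h2
  refine le_trans ?_ h2
  rw [← Nat.cast_sum]
  refine le_mul_of_one_le_right (by positivity) ?_
  rw [Real.le_log_iff_exp_le (by norm_num)]
  exact Real.exp_one_lt_d9.le.trans (by norm_num)

/-- For an entire function of order at most `3 / 2` the sum of `‖ρ‖⁻²` over the zeros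
converges. -/
lemma Differentiable.summable_order_div_norm_sq (hf : Differentiable ℂ f) (hf0 : f 0 = 1)
    (hC : 0 ≤ C) (hfC : ∀ z, ‖f z‖ ≤ Real.exp (C * (1 + ‖z‖) ^ (3 / 2 : ℝ))) :
    Summable fun ρ : {z | f z = 0} ↦ (analyticOrderNatAt f ρ : ℝ) / ‖(ρ : ℂ)‖ ^ 2 := by
  classical
  have hf0' : f 0 ≠ 0 := by simp [hf0]
  -- Dyadic majorant: level `j` contributes `4^(-j)` times the number of zeros in the disc of radius
  -- `2^j`, a geometric series of ratio `2^(3/2) / 4 < 1`.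
  set φ : ℕ × {z | f z = 0} → ℝ := fun p ↦
    if ‖(p.2 : ℂ)‖ ≤ 2 ^ p.1 then (analyticOrderNatAt f p.2 : ℝ) * (4 ^ p.1)⁻¹ else 0 with hφ
  have hφ0 : 0 ≤ φ := fun p ↦ by
    simp only [hφ, Pi.zero_apply]; split_ifs <;> positivity
  have hfin (j : ℕ) : {ρ : {z | f z = 0} | ‖(ρ : ℂ)‖ ≤ 2 ^ j}.Finite := by
    refine Set.Finite.of_finite_image (f := Subtype.val)
      ((hf.finite_zeros_closedBall hf0' (2 ^ j)).subset ?_) Subtype.val_injective.injOn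
    rintro _ ⟨ρ, hρ, rfl⟩
    exact ⟨hρ, ρ.2⟩
  have hsum (j : ℕ) : HasSum (fun ρ ↦ φ (j, ρ))
      ((∑ ρ ∈ hf.zerosIn hf0' (2 ^ j), (analyticOrderNatAt f ρ : ℝ)) * (4 ^ j)⁻¹) := by
    have h1 := hasSum_sum_of_ne_finset_zero (f := fun ρ ↦ φ (j, ρ)) (s := (hfin j).toFinset)
      (L := SummationFilter.unconditional _)
      (fun ρ hρ ↦ by
        have : ¬ ‖(ρ : ℂ)‖ ≤ 2 ^ j := by simpa using hρ
        simp [hφ, this])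
    convert h1 using 1
    rw [Finset.sum_mul]
    symm
    refine Finset.sum_bij (fun ρ _ ↦ (ρ : ℂ)) (fun ρ hρ ↦ ?_) (fun _ _ _ _ h ↦ Subtype.ext h)
      (fun ρ hρ ↦ ?_) (fun ρ hρ ↦ ?_)
    · exact (hf.mem_zerosIn hf0').2 ⟨by simpa using hρ, ρ.2⟩
    · obtain ⟨h1, h2⟩ := (hf.mem_zerosIn hf0').1 hρ
      exact ⟨⟨ρ, h2⟩, by simpa using h1, rfl⟩
    · have : ‖(ρ : ℂ)‖ ≤ 2 ^ j := by simpa using hρ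
      simp [hφ, this]
  have hφs : Summable φ := by
    rw [summable_prod_of_nonneg hφ0]
    refine ⟨fun j ↦ (hsum j).summable, ?_⟩
    simp only [(hsum _).tsum_eq]
    have hr : (0 : ℝ) ≤ 2 ^ (3 / 2 : ℝ) / 4 := by positivity
    have hr1 : (2 : ℝ) ^ (3 / 2 : ℝ) / 4 < 1 := by
      rw [div_lt_one (by norm_num)]
      calc (2 : ℝ) ^ (3 / 2 : ℝ) < 2 ^ (2 : ℝ) :=
            Real.rpow_lt_rpow_of_exponent_lt (by norm_num) (by norm_num)
        _ = 4 := by norm_num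
    refine Summable.of_nonneg_of_le (fun j ↦ by positivity) (fun j ↦ ?_)
      ((summable_geometric_of_lt_one hr hr1).mul_left (C * 5 ^ (3 / 2 : ℝ)))
    have h2j : (1 : ℝ) ≤ 2 ^ j := one_le_pow₀ (by norm_num)
    have h1 := hf.sum_order_zerosIn_le hf0 hfC (R := 2 ^ j) (by positivity)
    have h2 : (1 + 4 * 2 ^ j : ℝ) ^ (3 / 2 : ℝ) ≤ 5 ^ (3 / 2 : ℝ) * (2 ^ (3 / 2 : ℝ)) ^ j := by
      rw [← Real.rpow_natCast (2 ^ (3 / 2 : ℝ)), ← Real.rpow_mul (by norm_num), mul_comm (3 / 2 : ℝ),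
        Real.rpow_mul (by norm_num), Real.rpow_natCast,
        ← Real.mul_rpow (by norm_num) (by positivity)]
      exact Real.rpow_le_rpow (by positivity) (by linarith) (by norm_num)
    calc _ ≤ (C * (5 ^ (3 / 2 : ℝ) * (2 ^ (3 / 2 : ℝ)) ^ j)) * (4 ^ j)⁻¹ := by gcongr; exact h1.trans (by gcongr)
      _ = _ := by rw [div_pow]; ring
  refine Summable.of_norm_bounded_eventually ((hφs.prod_symm.prod).mul_left 4) ?_
  filter_upwards [(hfin 0).compl_mem_cofinite] with ρ hρ
  have hρ1 : 1 < ‖(ρ : ℂ)‖ := by simpa using hρ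
  -- A zero with `2^n ≤ ‖ρ‖ < 2^(n+1)` is already paid for by level `n + 1`, at the cost of a factor
  -- `4`.
  obtain ⟨n, hn1, hn2⟩ := exists_nat_pow_near hρ1.le (one_lt_two (α := ℝ))
  have h1 := (hφs.prod_symm.prod_factor ρ).le_tsum (n + 1) fun j _ ↦ hφ0 _
  have h2 : φ (n + 1, ρ) = (analyticOrderNatAt f ρ : ℝ) * (4 ^ (n + 1))⁻¹ := by
    simp [hφ, hn2.le]
  simp only [Prod.swap_prod_mk, h2] at h1 ⊢
  rw [Real.norm_of_nonneg (by positivity)]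
  calc (analyticOrderNatAt f ρ : ℝ) / ‖(ρ : ℂ)‖ ^ 2
      ≤ (analyticOrderNatAt f ρ : ℝ) / (2 ^ n) ^ 2 := by gcongr
    _ = 4 * ((analyticOrderNatAt f ρ : ℝ) * (4 ^ (n + 1))⁻¹) := by
        rw [← pow_mul, mul_comm n 2, pow_mul, pow_succ]
        norm_num
        field_simp
        ring
    _ ≤ _ := by gcongr

/-- All but finitely many zeros of an entire function are large. -/
lemma Differentiable.eventually_lt_norm_zeros (hf : Differentiable ℂ f) (hf0 : f 0 ≠ 0) (R : ℝ) :
    ∀ᶠ ρ : {z | f z = 0} in cofinite, R < ‖(ρ : ℂ)‖ := by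
  have : {ρ : {z | f z = 0} | ‖(ρ : ℂ)‖ ≤ R}.Finite := by
    refine Set.Finite.of_finite_image (f := Subtype.val)
      ((hf.finite_zeros_closedBall hf0 R).subset ?_) Subtype.val_injective.injOn
    rintro _ ⟨ρ, hρ, rfl⟩
    exact ⟨hρ, ρ.2⟩
  filter_upwards [this.compl_mem_cofinite] with ρ hρ
  simpa using hρ

/-- The partial fraction expansion of the logarithmic derivative of an entire function of order
at most `3 / 2`. -/
theorem Differentiable.hasSum_logDeriv_sub (hf : Differentiable ℂ f) (hf0 : f 0 = 1)
    (hC : 0 < C) (hfC : ∀ z, ‖f z‖ ≤ Real.exp (C * (1 + ‖z‖) ^ (3 / 2 : ℝ)))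
    {s : ℂ} (hs : f s ≠ 0) :
    HasSum (fun ρ : {z | f z = 0} ↦
      (analyticOrderNatAt f ρ : ℂ) * (1 / (s - ρ) + 1 / (ρ : ℂ)))
      (logDeriv f s - logDeriv f 0) := by
  classical
  have hf0' : f 0 ≠ 0 := by simp [hf0]
  have hz0 : ∀ z, f z = 0 → z ≠ 0 := by rintro z hz rfl; exact hf0' hz
  have hzs : ∀ z, f z = 0 → s - z ≠ 0 := by
    intro z hz h
    rw [sub_eq_zero] at h
    exact hs (h ▸ hz)
  have hsumm : Summable (fun ρ : {z | f z = 0} ↦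
      (analyticOrderNatAt f ρ : ℂ) * (1 / (s - ρ) + 1 / (ρ : ℂ))) := by
    refine Summable.of_norm_bounded_eventually
      ((hf.summable_order_div_norm_sq hf0 hC.le hfC).mul_left (2 * ‖s‖)) ?_
    filter_upwards [hf.eventually_lt_norm_zeros hf0' (2 * ‖s‖)] with ρ hρ
    have h1 : 1 / (s - ρ) + 1 / (ρ : ℂ) = s / (ρ * (s - ρ)) := by
      field_simp [hz0 ρ ρ.2, hzs ρ ρ.2]
      ring
    have hρ0 : 0 < ‖(ρ : ℂ)‖ := norm_pos_iff.2 (hz0 ρ ρ.2)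
    have h2 : ‖(ρ : ℂ)‖ / 2 ≤ ‖s - ρ‖ := by
      have := norm_sub_norm_le (ρ : ℂ) s
      rw [norm_sub_rev] at this
      linarith
    rw [h1, norm_mul, norm_div, norm_mul, Complex.norm_natCast]
    calc (analyticOrderNatAt f ρ : ℝ) * (‖s‖ / (‖(ρ : ℂ)‖ * ‖s - ρ‖))
        ≤ (analyticOrderNatAt f ρ : ℝ) * (‖s‖ / (‖(ρ : ℂ)‖ * (‖(ρ : ℂ)‖ / 2))) := by gcongr
      _ = _ := by field_simp
  -- Exhaustion by discs of radius `n + 1`, which is at least `1` for every `n`.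
  set Z : ℕ → Finset {z | f z = 0} := fun n ↦
    (hf.zerosIn hf0' (n + 1)).subtype (· ∈ {z | f z = 0}) with hZ
  have hZt : Tendsto Z atTop atTop := by
    refine tendsto_atTop_finset_of_monotone (fun a b hab ρ hρ ↦ ?_) fun ρ ↦ ?_
    · simp only [hZ, Finset.mem_subtype, hf.mem_zerosIn] at hρ ⊢
      exact ⟨hρ.1.trans (by gcongr), hρ.2⟩
    · obtain ⟨n, hn⟩ := exists_nat_ge ‖(ρ : ℂ)‖
      refine ⟨n, ?_⟩
      simp only [hZ, Finset.mem_subtype, hf.mem_zerosIn]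
      exact ⟨by linarith, ρ.2⟩
  have hlim : Tendsto (fun n ↦ ∑ ρ ∈ Z n,
      (analyticOrderNatAt f ρ : ℂ) * (1 / (s - ρ) + 1 / (ρ : ℂ))) atTop
      (𝓝 (logDeriv f s - logDeriv f 0)) := by
    rw [tendsto_iff_norm_sub_tendsto_zero]
    -- The error of the partial sum is exactly the variation of the logarithmic derivative of the
    -- zero-free quotient between `0` and `s`, hence `O(M / R²)` with `M = O(R^(3/2))`.
    have hb : ∀ᶠ n : ℕ in atTop, ‖∑ ρ ∈ Z n,
        (analyticOrderNatAt f ρ : ℂ) * (1 / (s - ρ) + 1 / (ρ : ℂ)) -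
          (logDeriv f s - logDeriv f 0)‖ ≤
        64 * C * 5 ^ (3 / 2 : ℝ) * ‖s‖ * ((n + 1 : ℝ) ^ (1 / 2 : ℝ))⁻¹ := by
      filter_upwards [eventually_gt_atTop ⌈8 * ‖s‖⌉₊] with n hn
      have hn' : ‖s‖ < (n + 1 : ℝ) / 8 := by
        have := (Nat.le_ceil (8 * ‖s‖)).trans_lt (Nat.cast_lt.2 hn)
        linarith
      set R : ℝ := n + 1 with hR
      have hRpos : 0 < R := by positivity
      set M := C * (1 + 4 * R) ^ (3 / 2 : ℝ) with hM
      obtain ⟨g, hg, hg0, hgne, hfg, hgB⟩ := hf.exists_zerosIn_factorization hf0 hRpos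
        (B := Real.exp M) fun z hz ↦ by rw [hM, ← hz]; exact hfC z
      have hgM : ∀ z ∈ ball (0 : ℂ) R, ‖g z‖ ≤ Real.exp M := fun z hz ↦ by
        rw [mem_ball_zero_iff] at hz
        refine le_trans ?_ (hgB z (by linarith))
        exact le_mul_of_one_le_right (norm_nonneg _) (one_le_pow₀ (by norm_num))
      have key := norm_logDeriv_sub_le_of_norm_le_exp hg hRpos (by positivity : 0 < M) hg0
        (fun z hz ↦ hgne z (mem_ball_zero_iff.1 hz).le) hgM hn'
      have hld : ∀ z, ‖z‖ ≤ R → f z ≠ 0 → logDeriv f z =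
          ∑ ρ ∈ hf.zerosIn hf0' R, (analyticOrderNatAt f ρ : ℂ) * (1 / (z - ρ)) +
            logDeriv g z := by
        intro z hz hfz
        have hfac : ∀ ρ ∈ hf.zerosIn hf0' R, 1 - z / ρ ≠ 0 := by
          intro ρ hρ h
          have hρ' := ((hf.mem_zerosIn hf0').1 hρ).2
          rw [sub_eq_zero, eq_comm, div_eq_one_iff_eq (hz0 ρ hρ')] at h
          exact hfz (h ▸ hρ')
        have hfeq : f = fun z ↦ (∏ ρ ∈ hf.zerosIn hf0' R,
          (1 - z / ρ) ^ analyticOrderNatAt f ρ) * g z := funext hfg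
        conv_lhs => rw [hfeq]
        rw [logDeriv_mul (f := fun z ↦ ∏ ρ ∈ hf.zerosIn hf0' R,
            (1 - z / ρ) ^ analyticOrderNatAt f ρ) _
            (Finset.prod_ne_zero_iff.2 fun ρ hρ ↦ pow_ne_zero _ (hfac ρ hρ)) (hgne z hz)
            (by fun_prop) (hg z), logDeriv_prod]
        · congr 1
          refine Finset.sum_congr rfl fun ρ hρ ↦ ?_
          have hρ0 := hz0 ρ ((hf.mem_zerosIn hf0').1 hρ).2
          have hd : _root_.deriv (fun z : ℂ ↦ 1 - z / ρ) z = -(1 / ρ) := by simp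
          rw [logDeriv_fun_pow (by fun_prop), logDeriv_apply, hd]
          congr 1
          have h1 := hfac ρ hρ
          have h2 : z - ρ ≠ 0 := by
            rw [sub_ne_zero]; rintro rfl; simp [hρ0] at h1
          have h3 : 1 - z / ρ = -(z - ρ) / ρ := by field_simp; ring
          rw [h3]
          field_simp
        · exact fun ρ hρ ↦ pow_ne_zero _ (hfac ρ hρ)
        · exact fun ρ hρ ↦ by fun_prop
      have hsum : ∑ ρ ∈ Z n, (analyticOrderNatAt f ρ : ℂ) * (1 / (s - ρ) + 1 / (ρ : ℂ)) =
          ∑ ρ ∈ hf.zerosIn hf0' R, (analyticOrderNatAt f ρ : ℂ) * (1 / (s - ρ) + 1 / ρ) :=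
        Finset.sum_subtype_of_mem (fun ρ : ℂ ↦ (analyticOrderNatAt f ρ : ℂ) * (1 / (s - ρ) + 1 / ρ))
          fun ρ hρ ↦ ((hf.mem_zerosIn hf0').1 hρ).2
      rw [hsum, hld s (by linarith [norm_nonneg s]) hs, hld 0 (by simp [hRpos.le]) hf0']
      have : ∑ ρ ∈ hf.zerosIn hf0' R, (analyticOrderNatAt f ρ : ℂ) * (1 / (s - ρ) + 1 / ρ) -
          (∑ ρ ∈ hf.zerosIn hf0' R, (analyticOrderNatAt f ρ : ℂ) * (1 / (s - ρ)) + logDeriv g s -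
          (∑ ρ ∈ hf.zerosIn hf0' R, (analyticOrderNatAt f ρ : ℂ) * (1 / (0 - ρ)) +
            logDeriv g 0)) = -(logDeriv g s - logDeriv g 0) := by
        have h0 : ∀ ρ : ℂ, (1 : ℂ) / (0 - ρ) = -(1 / ρ) := fun ρ ↦ by rw [zero_sub, div_neg]
        simp only [mul_add, Finset.sum_add_distrib, h0, mul_neg, Finset.sum_neg_distrib]
        ring
      rw [this, norm_neg]
      refine key.trans ?_
      have hR1 : 1 ≤ R := by simp [hR]
      have h5 : (1 + 4 * R) ^ (3 / 2 : ℝ) ≤ 5 ^ (3 / 2 : ℝ) * R ^ (3 / 2 : ℝ) := by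
        rw [← Real.mul_rpow (by norm_num) hRpos.le]
        exact Real.rpow_le_rpow (by positivity) (by linarith) (by norm_num)
      have h6 : R ^ (3 / 2 : ℝ) / R ^ 2 = (R ^ (1 / 2 : ℝ))⁻¹ := by
        rw [← Real.rpow_natCast R 2, ← Real.rpow_sub hRpos, ← Real.rpow_neg hRpos.le]
        norm_num
      calc 64 * M / R ^ 2 * ‖s‖ ≤ 64 * (C * (5 ^ (3 / 2 : ℝ) * R ^ (3 / 2 : ℝ))) / R ^ 2 * ‖s‖ := by
            rw [hM]; gcongr
        _ = 64 * C * 5 ^ (3 / 2 : ℝ) * ‖s‖ * (R ^ (3 / 2 : ℝ) / R ^ 2) := by ring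
        _ = _ := by rw [h6]
    refine squeeze_zero' (Eventually.of_forall fun _ ↦ norm_nonneg _) hb ?_
    rw [← mul_zero (64 * C * 5 ^ (3 / 2 : ℝ) * ‖s‖)]
    refine Tendsto.const_mul _ (tendsto_inv_atTop_zero.comp ?_)
    exact (tendsto_rpow_atTop (by norm_num)).comp
      (tendsto_atTop_add_const_right _ _ tendsto_natCast_atTop_atTop)
  have := hsumm.hasSum
  -- Absolute convergence is known, so the limit along discs is the unconditional sum.
  rwa [tendsto_nhds_unique (this.comp hZt) hlim] at this

end GrowthOrder

end

section

open Filter Topology MeasureTheory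

/-! ### The entire function `s (s - 1) Λ₀(s) + 1` -/

/-- Twice the Riemann xi function, `s (s - 1) Λ(s)`, as an entire function. -/
noncomputable def entireXi (s : ℂ) : ℂ := s * (s - 1) * completedRiemannZeta₀ s + 1

lemma differentiable_entireXi : Differentiable ℂ entireXi :=
  ((differentiable_id.mul (differentiable_id.sub_const 1)).mul
    differentiable_completedZeta₀).add_const 1

lemma entireXi_zero : entireXi 0 = 1 := by simp [entireXi]

lemma entireXi_one : entireXi 1 = 1 := by simp [entireXi]

lemma entireXi_one_sub (s : ℂ) : entireXi (1 - s) = entireXi s := by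
  simp only [entireXi, completedRiemannZeta₀_one_sub]
  ring

lemma entireXi_eq_completedRiemannZeta {s : ℂ} (h0 : s ≠ 0) (h1 : s ≠ 1) :
    entireXi s = s * (s - 1) * completedRiemannZeta s := by
  have h1' : 1 - s ≠ 0 := sub_ne_zero.2 h1.symm
  rw [entireXi, completedRiemannZeta_eq]
  field_simp
  ring

lemma entireXi_eq_of_re_pos {s : ℂ} (h0 : 0 < s.re) (h1 : s ≠ 1) :
    entireXi s = s * (s - 1) * s.Gammaℝ * riemannZeta s := by
  have hs : s ≠ 0 := by rintro rfl; simp at h0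
  rw [entireXi_eq_completedRiemannZeta hs h1, riemannZeta_def_of_ne_zero hs]
  field_simp [Complex.Gammaℝ_ne_zero_of_re_pos h0]

lemma entireXi_ne_zero_of_one_le_re {s : ℂ} (hs : 1 ≤ s.re) : entireXi s ≠ 0 := by
  by_cases h1 : s = 1
  · simp [h1, entireXi_one]
  · have h0 : s ≠ 0 := by rintro rfl; norm_num at hs
    rw [entireXi_eq_of_re_pos (by linarith) h1]
    exact mul_ne_zero (mul_ne_zero (mul_ne_zero h0 (sub_ne_zero.2 h1))
      (Complex.Gammaℝ_ne_zero_of_re_pos (by linarith))) (riemannZeta_ne_zero_of_one_le_re hs)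

/-- The zeros of the xi function are the nontrivial zeros of zeta. -/
lemma setOf_entireXi_eq_zero : {s | entireXi s = 0} = nontrivialZetaZeros := by
  ext s
  simp only [nontrivialZetaZeros, Set.mem_ofPred_eq]
  constructor
  · intro h
    have h1 : s.re < 1 := by
      by_contra! h1
      exact entireXi_ne_zero_of_one_le_re h1 h
    have h0 : 0 < s.re := by
      -- The left half-plane is reflected by the functional equation.
      by_contra! h0
      refine entireXi_ne_zero_of_one_le_re (s := 1 - s) (by simpa using h0) ?_
      rw [entireXi_one_sub, h]
    refine ⟨h0, h1, ?_⟩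
    have hs1 : s ≠ 1 := by rintro rfl; simp at h1
    have hs0 : s ≠ 0 := by rintro rfl; simp at h0
    rw [entireXi_eq_of_re_pos h0 hs1] at h
    simpa [hs0, sub_ne_zero.2 hs1, Complex.Gammaℝ_ne_zero_of_re_pos h0] using h
  · rintro ⟨h0, h1, h⟩
    have hs1 : s ≠ 1 := by rintro rfl; simp at h1
    rw [entireXi_eq_of_re_pos h0 hs1, h, mul_zero]

/-- `Gammaℝ` is the inverse of an entire function that is nonzero here. -/
lemma differentiableAt_Gammaℝ {s : ℂ} (hs : 0 < s.re) : DifferentiableAt ℂ Complex.Gammaℝ s := by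
  have h := (Complex.differentiable_Gammaℝ_inv s).inv
    (inv_ne_zero (Complex.Gammaℝ_ne_zero_of_re_pos hs))
  exact h.congr_of_eventuallyEq (Eventually.of_forall fun z ↦ (inv_inv _).symm)

/-- The multiplicities of the zeros of xi and zeta agree. -/
lemma analyticOrderNatAt_entireXi {s : ℂ} (hs : s ∈ nontrivialZetaZeros) :
    analyticOrderNatAt entireXi s = analyticOrderNatAt riemannZeta s := by
  obtain ⟨h0, h1, -⟩ := hs
  have hs1 : s ≠ 1 := by rintro rfl; simp at h1
  have hs0 : s ≠ 0 := by rintro rfl; simp at h0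
  set U : Set ℂ := {z | 0 < z.re} with hU
  have hUo : IsOpen U := isOpen_lt continuous_const Complex.continuous_re
  -- Near `s` the functions `entireXi` and zeta differ by the nonvanishing analytic factor `u`.
  set u : ℂ → ℂ := fun z ↦ z * (z - 1) * z.Gammaℝ with hu
  have hua : AnalyticAt ℂ u s := by
    refine DifferentiableOn.analyticAt (s := U) (fun z hz ↦ ?_) (hUo.mem_nhds h0)
    exact ((by fun_prop : DifferentiableAt ℂ (fun z : ℂ ↦ z * (z - 1)) z).mul
      (differentiableAt_Gammaℝ hz)).differentiableWithinAt
  have hus : u s ≠ 0 := mul_ne_zero (mul_ne_zero hs0 (sub_ne_zero.2 hs1))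
    (Complex.Gammaℝ_ne_zero_of_re_pos h0)
  have heq : entireXi =ᶠ[𝓝 s] u * riemannZeta := by
    filter_upwards [hUo.mem_nhds h0, isOpen_ne.mem_nhds hs1] with z hz hz1
    exact entireXi_eq_of_re_pos hz hz1
  rw [analyticOrderNatAt, analyticOrderAt_congr heq,
    analyticOrderAt_mul hua (analyticOn_riemannZeta s hs1),
    hua.analyticOrderAt_eq_zero.2 hus, zero_add, analyticOrderNatAt]

/-! ### Growth of the xi function -/

lemma norm_Gamma_le_Gamma_re {s : ℂ} (hs : 0 < s.re) : ‖Complex.Gamma s‖ ≤ Real.Gamma s.re := by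
  rw [Complex.Gamma_eq_integral hs, Real.Gamma_eq_integral hs, Complex.GammaIntegral]
  refine (norm_integral_le_integral_norm _).trans_eq ?_
  refine setIntegral_congr_fun measurableSet_Ioi fun t ht ↦ ?_
  rw [Set.mem_Ioi] at ht
  simp only [norm_mul, Complex.norm_real, Real.norm_eq_abs, Real.abs_exp]
  rw [Complex.norm_cpow_eq_rpow_re_of_pos ht]
  simp

/-- With `N = ⌈x⌉`, monotonicity on `[2, ∞)` gives `Γ(x) ≤ N! ≤ N^N`, and `log N ≤ 2 (1 + x)^(1/2)`.
-/
lemma Gamma_le_exp {x : ℝ} (hx : 2 ≤ x) :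
    Real.Gamma x ≤ Real.exp (2 * (1 + x) ^ (3 / 2 : ℝ)) := by
  have hle : x ≤ ⌈x⌉₊ := Nat.le_ceil x
  have hlt : (⌈x⌉₊ : ℝ) < 1 + x := by
    have := Nat.ceil_lt_add_one (by linarith : 0 ≤ x)
    linarith
  have h1 : Real.Gamma x ≤ Real.Gamma (⌈x⌉₊ + 1) :=
    Real.Gamma_strictMonoOn_Ici.monotoneOn hx (Set.mem_Ici.2 (by linarith)) (by linarith)
  have hpos : (0 : ℝ) < ⌈x⌉₊ := by linarith
  rw [Real.Gamma_nat_eq_factorial] at h1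
  have h2 : ((⌈x⌉₊).factorial : ℝ) ≤ (⌈x⌉₊ : ℝ) ^ ⌈x⌉₊ := by
    exact_mod_cast Nat.factorial_le_pow _
  refine h1.trans (h2.trans ?_)
  rw [← Real.exp_log (pow_pos hpos _), Real.log_pow]
  refine Real.exp_le_exp.2 ?_
  have h3 : Real.log ⌈x⌉₊ ≤ 2 * (1 + x) ^ (1 / 2 : ℝ) := by
    refine (Real.log_le_log hpos hlt.le).trans ?_
    refine (Real.log_le_rpow_div (by linarith) (by norm_num : (0 : ℝ) < 1 / 2)).trans_eq ?_
    ring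
  calc (⌈x⌉₊ : ℝ) * Real.log ⌈x⌉₊ ≤ (1 + x) * (2 * (1 + x) ^ (1 / 2 : ℝ)) := by
        gcongr
    _ = 2 * (1 + x) ^ (3 / 2 : ℝ) := by
        rw [show (3 / 2 : ℝ) = 1 + 1 / 2 by norm_num, Real.rpow_add (by linarith), Real.rpow_one]
        ring

lemma norm_Gammaℝ_le_exp {s : ℂ} (hs : 4 ≤ s.re) :
    ‖s.Gammaℝ‖ ≤ Real.exp (2 * (1 + ‖s‖) ^ (3 / 2 : ℝ)) := by
  have hre : (s / 2).re = s.re / 2 := by simp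
  rw [Complex.Gammaℝ_def, norm_mul, Complex.norm_cpow_eq_rpow_re_of_pos Real.pi_pos]
  have h1 : Real.pi ^ (-s / 2).re ≤ 1 := by
    refine Real.rpow_le_one_of_one_le_of_nonpos (by linarith [Real.pi_gt_three]) ?_
    simp; linarith
  have h2 : ‖Complex.Gamma (s / 2)‖ ≤ Real.exp (2 * (1 + ‖s‖) ^ (3 / 2 : ℝ)) := by
    refine (norm_Gamma_le_Gamma_re (by rw [hre]; linarith)).trans ?_
    rw [hre]
    refine (Gamma_le_exp (by linarith)).trans ?_
    have := Complex.re_le_norm s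
    gcongr
    linarith
  calc _ ≤ 1 * Real.exp (2 * (1 + ‖s‖) ^ (3 / 2 : ℝ)) := by gcongr
    _ = _ := one_mul _

/-- `Λ₀` is bounded on vertical strips. -/
lemma exists_norm_completedRiemannZeta₀_le (a b : ℝ) :
    ∃ B : ℝ, 0 ≤ B ∧ ∀ s : ℂ, a ≤ s.re → s.re ≤ b → ‖completedRiemannZeta₀ s‖ ≤ B := by
  set P := HurwitzZeta.hurwitzEvenFEPair 0
  have hconv (s : ℂ) : MellinConvergent P.f_modif s :=
    (P.isStrongFEPair_toStrongFEPair.hasMellin s).1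
  have hnorm (s : ℂ) (t : ℝ) (ht : t ∈ Set.Ioi (0 : ℝ)) :
      ‖(t : ℂ) ^ (s - 1) • P.f_modif t‖ = t ^ (s.re - 1) * ‖P.f_modif t‖ := by
    rw [norm_smul, Complex.norm_cpow_eq_rpow_re_of_pos ht]; simp
  have hint (r : ℝ) : IntegrableOn (fun t : ℝ ↦ t ^ (r - 1) * ‖P.f_modif t‖) (Set.Ioi 0) := by
    refine (IntegrableOn.congr_fun (hconv r).norm (fun t ht ↦ ?_) measurableSet_Ioi)
    rw [hnorm r t ht]; simp
  -- The Mellin integral converges absolutely for every `s`. For real part in `[a, b]` its weight is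
  -- dominated by the sum of the two endpoint weights, one for `t ≤ 1` and one for `t ≥ 1`.
  set B := ∫ t in Set.Ioi (0 : ℝ), (t ^ (a / 2 - 1) * ‖P.f_modif t‖ +
    t ^ (b / 2 - 1) * ‖P.f_modif t‖) with hB
  have hB0 : 0 ≤ B := setIntegral_nonneg measurableSet_Ioi fun t ht ↦ by
    rw [Set.mem_Ioi] at ht; positivity
  refine ⟨B, hB0, fun s ha hb ↦ ?_⟩
  have h1 : completedRiemannZeta₀ s = mellin P.f_modif (s / 2) / 2 := rfl
  have h2 : ‖mellin P.f_modif (s / 2)‖ ≤ B := by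
    refine norm_integral_le_of_norm_le ((hint _).add (hint _)) ?_
    filter_upwards [ae_restrict_mem measurableSet_Ioi] with t ht
    rw [hnorm _ t ht]
    have ht' : 0 < t := ht
    have hre : (s / 2).re = s.re / 2 := by simp
    rw [hre, ← add_mul]
    refine mul_le_mul_of_nonneg_right ?_ (norm_nonneg _)
    rcases le_total t 1 with h | h
    · have := Real.rpow_le_rpow_of_exponent_ge ht' h (by linarith : a / 2 - 1 ≤ s.re / 2 - 1)
      have := Real.rpow_nonneg ht'.le (b / 2 - 1)
      linarith
    · have := Real.rpow_le_rpow_of_exponent_le h (by linarith : s.re / 2 - 1 ≤ b / 2 - 1)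
      have := Real.rpow_nonneg ht'.le (a / 2 - 1)
      linarith
  rw [h1, norm_div, Complex.norm_two]
  linarith

lemma norm_riemannZeta_le {s : ℂ} (hs : 2 ≤ s.re) :
    ‖riemannZeta s‖ ≤ ∑' n : ℕ, 1 / (n : ℝ) ^ (2 : ℝ) := by
  rw [zeta_eq_tsum_one_div_nat_cpow (by linarith)]
  refine tsum_of_norm_bounded (Real.summable_one_div_nat_rpow.2 (by norm_num)).hasSum fun n ↦ ?_
  -- The term `n = 0` is `1 / 0 = 0` on both sides.
  rcases Nat.eq_zero_or_pos n with rfl | hn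
  · have : s ≠ 0 := by rintro rfl; norm_num at hs
    simp [this]
  · rw [norm_div, norm_one, Complex.norm_natCast_cpow_of_pos hn]
    have : (1 : ℝ) ≤ n := by exact_mod_cast hn
    gcongr

/-- The xi function has order at most `3 / 2`. -/
lemma exists_norm_entireXi_le :
    ∃ C : ℝ, 0 < C ∧ ∀ s, ‖entireXi s‖ ≤ Real.exp (C * (1 + ‖s‖) ^ (3 / 2 : ℝ)) := by
  obtain ⟨B, hB0, hB⟩ := exists_norm_completedRiemannZeta₀_le (-3) 4
  set D : ℝ := ∑' n : ℕ, 1 / (n : ℝ) ^ (2 : ℝ) with hD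
  have hD0 : 0 ≤ D := tsum_nonneg fun n ↦ by positivity
  set E := B + D + 1 with hE
  have hone : ∀ s : ℂ, (1 : ℝ) ≤ (1 + ‖s‖) ^ (3 / 2 : ℝ) := fun s ↦
    Real.one_le_rpow (by linarith [norm_nonneg s]) (by norm_num)
  have hsq : ∀ s : ℂ, (1 + ‖s‖) ^ 2 ≤ Real.exp (2 * (1 + ‖s‖) ^ (3 / 2 : ℝ)) := by
    intro s
    have h1 : 1 + ‖s‖ ≤ Real.exp ((1 + ‖s‖) ^ (3 / 2 : ℝ)) := by
      refine le_trans ?_ (Real.add_one_le_exp _)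
      have : (1 + ‖s‖) ^ (1 : ℝ) ≤ (1 + ‖s‖) ^ (3 / 2 : ℝ) :=
        Real.rpow_le_rpow_of_exponent_le (by linarith [norm_nonneg s]) (by norm_num)
      rw [Real.rpow_one] at this
      linarith
    calc (1 + ‖s‖) ^ 2 ≤ (Real.exp ((1 + ‖s‖) ^ (3 / 2 : ℝ))) ^ 2 := by gcongr
      _ = _ := by rw [← Real.exp_nat_mul]; norm_num
  have hss : ∀ s : ℂ, ‖s * (s - 1)‖ ≤ (1 + ‖s‖) ^ 2 := by
    intro s
    rw [norm_mul]
    have := norm_sub_le s 1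
    rw [norm_one] at this
    nlinarith [norm_nonneg s]
  have hE1 : 1 ≤ E := by linarith
  have hstrip : ∀ s : ℂ, -3 ≤ s.re → s.re ≤ 4 →
      ‖entireXi s‖ ≤ E * Real.exp (4 * (1 + ‖s‖) ^ (3 / 2 : ℝ)) := by
    intro s h1 h2
    have h3 := hB s h1 h2
    have h4 : 1 ≤ (1 + ‖s‖) ^ 2 := one_le_pow₀ (by linarith [norm_nonneg s])
    calc ‖entireXi s‖ ≤ ‖s * (s - 1)‖ * ‖completedRiemannZeta₀ s‖ + 1 := by
          rw [entireXi, ← norm_mul]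
          exact (norm_add_le _ _).trans_eq (by rw [norm_one])
      _ ≤ (1 + ‖s‖) ^ 2 * B + (1 + ‖s‖) ^ 2 * 1 := by
          gcongr
          · exact hss s
          · linarith
      _ ≤ E * (1 + ‖s‖) ^ 2 := by nlinarith
      _ ≤ E * Real.exp (2 * (1 + ‖s‖) ^ (3 / 2 : ℝ)) := by gcongr; exact hsq s
      _ ≤ _ := by gcongr; norm_num
  have hright : ∀ s : ℂ, 4 ≤ s.re →
      ‖entireXi s‖ ≤ E * Real.exp (4 * (1 + ‖s‖) ^ (3 / 2 : ℝ)) := by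
    intro s h1
    have hs1 : s ≠ 1 := by rintro rfl; norm_num at h1
    rw [entireXi_eq_of_re_pos (by linarith) hs1, norm_mul, norm_mul]
    calc _ ≤ (1 + ‖s‖) ^ 2 * Real.exp (2 * (1 + ‖s‖) ^ (3 / 2 : ℝ)) * D := by
          gcongr
          · exact hss s
          · exact norm_Gammaℝ_le_exp h1
          · exact norm_riemannZeta_le (by linarith)
      _ ≤ Real.exp (2 * (1 + ‖s‖) ^ (3 / 2 : ℝ)) * Real.exp (2 * (1 + ‖s‖) ^ (3 / 2 : ℝ)) * E := by
          gcongr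
          · exact hsq s
          · linarith
      _ = _ := by rw [← Real.exp_add]; ring_nf
  have hhalf : ∀ s : ℂ, -3 ≤ s.re →
      ‖entireXi s‖ ≤ E * Real.exp (4 * (1 + ‖s‖) ^ (3 / 2 : ℝ)) := fun s h1 ↦
    (le_total s.re 4).elim (hstrip s h1) (hright s)
  -- Reflection `s ↦ 1 - s` at most doubles `1 + ‖s‖`, and `4 · 2^(3/2) ≤ 16`; the factor `E` is
  -- absorbed by `E ≤ exp E`.
  refine ⟨16 + E, by linarith, fun s ↦ ?_⟩
  have hall : ‖entireXi s‖ ≤ E * Real.exp (16 * (1 + ‖s‖) ^ (3 / 2 : ℝ)) := by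
    rcases le_total (-3) s.re with h | h
    · refine (hhalf s h).trans ?_
      gcongr
      norm_num
    · rw [← entireXi_one_sub]
      refine (hhalf (1 - s) (by simp; linarith)).trans ?_
      have h1 : (1 + ‖1 - s‖) ^ (3 / 2 : ℝ) ≤ 4 * (1 + ‖s‖) ^ (3 / 2 : ℝ) := by
        calc (1 + ‖1 - s‖) ^ (3 / 2 : ℝ) ≤ (2 * (1 + ‖s‖)) ^ (3 / 2 : ℝ) := by
              have := norm_sub_le 1 s
              rw [norm_one] at this
              gcongr
              linarith [norm_nonneg s]
          _ = 2 ^ (3 / 2 : ℝ) * (1 + ‖s‖) ^ (3 / 2 : ℝ) := by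
              rw [Real.mul_rpow (by norm_num) (by positivity)]
          _ ≤ 2 ^ (2 : ℝ) * (1 + ‖s‖) ^ (3 / 2 : ℝ) := by
              gcongr <;> norm_num
          _ = _ := by norm_num
      exact mul_le_mul_of_nonneg_left (Real.exp_le_exp.2 (by linarith)) (by linarith)
  refine hall.trans ?_
  calc E * Real.exp (16 * (1 + ‖s‖) ^ (3 / 2 : ℝ))
      ≤ Real.exp (E * (1 + ‖s‖) ^ (3 / 2 : ℝ)) * Real.exp (16 * (1 + ‖s‖) ^ (3 / 2 : ℝ)) := by
        gcongr
        have := Real.add_one_le_exp (E * (1 + ‖s‖) ^ (3 / 2 : ℝ))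
        nlinarith [hone s]
    _ = _ := by rw [← Real.exp_add]; ring_nf

end

section

open Filter Topology

/-! ### The series of the digamma function -/

section Digamma

lemma hasDerivAt_log_Gamma_real {x : ℝ} (hx : 0 < x) :
    HasDerivAt (Real.log ∘ Real.Gamma) (deriv (Real.log ∘ Real.Gamma) x) x := by
  refine DifferentiableAt.hasDerivAt ((Real.differentiableAt_Gamma ?_).log (Real.Gamma_ne_zero ?_))
  all_goals exact fun m ↦ ne_of_gt (by have := m.cast_nonneg (α := ℝ); linarith)

lemma digamma_ofReal {x : ℝ} (hx : 0 < x) :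
    Complex.digamma x = (deriv (Real.log ∘ Real.Gamma) x : ℝ) := by
  have hd : DifferentiableAt ℝ Real.Gamma x := Real.differentiableAt_Gamma
    fun m ↦ ne_of_gt (by have := m.cast_nonneg (α := ℝ); linarith)
  have hc : DifferentiableAt ℂ Complex.Gamma x := Complex.differentiableAt_Gamma _ fun m h ↦ by
    have h2 := congr_arg Complex.re h
    simp at h2
    have := m.cast_nonneg (α := ℝ)
    linarith
  have h1 : deriv Complex.Gamma x = (deriv Real.Gamma x : ℝ) := by
    have h2 := hc.hasDerivAt.comp_ofReal
    have h3 := hd.hasDerivAt.ofReal_comp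
    simp only [Complex.Gamma_ofReal] at h2
    exact h2.unique h3
  rw [Complex.digamma_def, logDeriv_apply, h1, Complex.Gamma_ofReal]
  have h4 : deriv (Real.log ∘ Real.Gamma) x = deriv Real.Gamma x / Real.Gamma x :=
    deriv.log hd (Real.Gamma_pos_of_pos hx).ne'
  rw [h4]
  push_cast
  rfl

lemma digamma_add_nat {z : ℂ} (hz : 0 < z.re) (n : ℕ) :
    Complex.digamma (z + n) = Complex.digamma z + ∑ k ∈ Finset.range n, 1 / (z + k) := by
  induction n with
  | zero => simp
  | succ n ih =>
    rw [Nat.cast_succ, ← add_assoc, Complex.digamma_apply_add_one, ih, Finset.sum_range_succ,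
      one_div (z + n)]
    · ring
    · intro m h
      have h2 := congr_arg Complex.re h
      simp at h2
      have := m.cast_nonneg (α := ℝ)
      have := n.cast_nonneg (α := ℝ)
      linarith

/-- `digamma (x + n) - digamma n` tends to `0` for real `x`. -/
lemma tendsto_digamma_real_sub {x : ℝ} (hx : 0 < x) :
    Tendsto (fun n : ℕ ↦ Complex.digamma ((x + 1 : ℝ) + n) - Complex.digamma (1 + n)) atTop
      (𝓝 0) := by
  set ψ := deriv (Real.log ∘ Real.Gamma) with hψ
  -- Log-convexity of Gamma makes `ψ` monotone, so a real shift `x` lies between the integer shifts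
  -- `0` and `⌈x⌉`, which the recurrence controls.
  have hmono : MonotoneOn ψ (Set.Ioi 0) := Real.convexOn_log_Gamma.monotoneOn_deriv
    fun x hx ↦ (hasDerivAt_log_Gamma_real hx).differentiableAt
  have hcast1 (n : ℕ) : Complex.digamma ((x + 1 : ℝ) + n) = (ψ (x + 1 + n) : ℝ) := by
    rw [← digamma_ofReal (by positivity)]; push_cast; rfl
  have hcast2 (n : ℕ) : Complex.digamma (1 + n) = (ψ (1 + n) : ℝ) := by
    rw [← digamma_ofReal (by positivity)]; push_cast; rfl
  set m := ⌈x⌉₊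
  have hup (n : ℕ) : ψ (1 + n + m) - ψ (1 + n) ≤ m * (1 / ((n : ℝ) + 1)) := by
    have h1 := digamma_add_nat (z := ((1 + n : ℝ) : ℂ)) (by simp; positivity) m
    have h2 : ψ (1 + n + m) = ψ (1 + n) + ∑ k ∈ Finset.range m, 1 / ((1 + n : ℝ) + k) := by
      have h3 : Complex.digamma (((1 + n : ℝ) : ℂ) + m) = (ψ (1 + n + m) : ℝ) := by
        rw [← digamma_ofReal (by positivity)]; push_cast; rfl
      rw [h3, digamma_ofReal (by positivity)] at h1
      exact_mod_cast h1
    rw [h2, add_sub_cancel_left]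
    calc ∑ k ∈ Finset.range m, 1 / ((1 + n : ℝ) + k)
        ≤ ∑ k ∈ Finset.range m, 1 / ((n : ℝ) + 1) := by
          refine Finset.sum_le_sum fun k _ ↦ ?_
          apply one_div_le_one_div_of_le (by positivity)
          have := k.cast_nonneg (α := ℝ)
          linarith
      _ = _ := by simp
  have hlim : Tendsto (fun n : ℕ ↦ ψ (x + 1 + n) - ψ (1 + n)) atTop (𝓝 0) := by
    refine squeeze_zero (fun n ↦ ?_) (fun n ↦ ?_)
      ((mul_zero (m : ℝ)) ▸ tendsto_one_div_add_atTop_nhds_zero_nat.const_mul (m : ℝ))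
    · exact sub_nonneg.2 (hmono (Set.mem_Ioi.2 (by positivity)) (Set.mem_Ioi.2 (by positivity))
        (by linarith))
    · refine le_trans (sub_le_sub_right (hmono (Set.mem_Ioi.2 (by positivity))
        (Set.mem_Ioi.2 (by positivity)) ?_) _) (hup n)
      have := Nat.le_ceil x
      linarith
  have := (Complex.continuous_ofReal.tendsto 0).comp hlim
  simp only [Complex.ofReal_zero] at this
  refine this.congr fun n ↦ ?_
  rw [hcast1, hcast2]
  simp

lemma norm_digamma_term_le {z : ℂ} (hz : 0 < z.re) (n : ℕ) :
    ‖1 / (n + 1 : ℂ) - 1 / (n + 1 + z)‖ ≤ ‖z‖ * (1 / ((n : ℝ) + 1) ^ 2) := by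
  have h1 : (n + 1 : ℂ) ≠ 0 := by exact_mod_cast n.succ_ne_zero
  have hre : (n : ℝ) + 1 ≤ ‖(n + 1 + z : ℂ)‖ := by
    refine le_trans ?_ (Complex.re_le_norm _)
    simp; linarith
  have hpos : (0 : ℝ) < n + 1 := by positivity
  have h2 : (n + 1 + z : ℂ) ≠ 0 := norm_pos_iff.1 (hpos.trans_le hre)
  have h3 : 1 / (n + 1 : ℂ) - 1 / (n + 1 + z) = z / ((n + 1) * (n + 1 + z)) := by
    field_simp
    ring
  have h4 : ‖(n + 1 : ℂ)‖ = n + 1 := by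
    exact_mod_cast Complex.norm_natCast (n + 1)
  rw [h3, norm_div, norm_mul, h4, div_eq_mul_one_div, sq]
  gcongr

lemma summable_one_div_nat_add_one_sq : Summable fun n : ℕ ↦ 1 / ((n : ℝ) + 1) ^ 2 := by
  have := (summable_nat_add_iff 1).2 (Real.summable_one_div_nat_pow.2 one_lt_two)
  simpa using this

lemma summable_digamma_term {z : ℂ} (hz : 0 < z.re) :
    Summable fun n : ℕ ↦ 1 / (n + 1 : ℂ) - 1 / (n + 1 + z) :=
  Summable.of_norm_bounded (summable_one_div_nat_add_one_sq.mul_left ‖z‖)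
    (norm_digamma_term_le hz)

/-- The series expansion of the digamma function. -/
theorem hasSum_digamma {z : ℂ} (hz : 0 < z.re) :
    HasSum (fun n : ℕ ↦ 1 / (n + 1 : ℂ) - 1 / (n + 1 + z))
      (Complex.digamma z + 1 / z + Real.eulerMascheroniConstant) := by
  -- For positive reals the partial sums telescope by the recurrence, with a remainder tending to
  -- `0`; the identity theorem then extends the formula.
  have hreal {x : ℝ} (hx : 0 < x) : HasSum (fun n : ℕ ↦ 1 / (n + 1 : ℂ) - 1 / (n + 1 + x))
      (Complex.digamma x + 1 / x + Real.eulerMascheroniConstant) := by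
    have hs := (summable_digamma_term (z := x) (by simpa)).hasSum
    have hx0 : ∀ m : ℕ, (x : ℂ) ≠ -m := by
      intro m h
      have h2 := congr_arg Complex.re h
      simp at h2
      have := m.cast_nonneg (α := ℝ)
      linarith
    have h1 : Complex.digamma (x + 1 : ℝ) = Complex.digamma x + 1 / x := by
      push_cast
      rw [Complex.digamma_apply_add_one _ hx0, one_div]
    have hlim : Tendsto (fun n : ℕ ↦ ∑ k ∈ Finset.range n, (1 / (k + 1 : ℂ) - 1 / (k + 1 + x)))
        atTop (𝓝 (Complex.digamma x + 1 / x + Real.eulerMascheroniConstant)) := by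
      have h2 := (tendsto_digamma_real_sub hx).const_sub
        (Complex.digamma x + 1 / x + Real.eulerMascheroniConstant)
      rw [sub_zero] at h2
      refine h2.congr fun n ↦ ?_
      rw [digamma_add_nat (by simp; linarith), digamma_add_nat (by simp), Complex.digamma_one, h1,
        Finset.sum_sub_distrib]
      have e1 : ∑ k ∈ Finset.range n, 1 / (((x + 1 : ℝ) : ℂ) + k) =
          ∑ k ∈ Finset.range n, 1 / ((k : ℂ) + 1 + x) :=
        Finset.sum_congr rfl fun k _ ↦ by push_cast; ring_nf
      have e2 : ∑ k ∈ Finset.range n, 1 / ((1 : ℂ) + k) =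
          ∑ k ∈ Finset.range n, 1 / ((k : ℂ) + 1) :=
        Finset.sum_congr rfl fun k _ ↦ by ring_nf
      rw [e1, e2]
      ring
    rwa [tendsto_nhds_unique hs.tendsto_sum_nat hlim] at hs
  set R : ℝ := ‖z‖ + 1 with hR
  -- A bounded convex piece of the half-plane containing `z`: there the terms are uniformly at most
  -- `R / (n + 1)²`, so the series is holomorphic.
  set U : Set ℂ := {w | 0 < w.re} ∩ Metric.ball 0 R with hU
  have hUo : IsOpen U := (isOpen_lt continuous_const Complex.continuous_re).inter Metric.isOpen_ball
  have hUc : Convex ℝ U := (convex_halfSpace_re_gt 0).inter (convex_ball _ _)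
  have hd1 : DifferentiableOn ℂ (fun w ↦ ∑' n : ℕ, (1 / (n + 1 : ℂ) - 1 / (n + 1 + w))) U := by
    refine Complex.differentiableOn_tsum_of_summable_norm
      (summable_one_div_nat_add_one_sq.mul_left R) (fun n w hw ↦ ?_) hUo (fun n w hw ↦ ?_)
    · have : (n + 1 + w : ℂ) ≠ 0 := by
        intro h
        have h2 := congr_arg Complex.re h
        simp at h2
        have h3 : 0 < w.re := hw.1
        have := n.cast_nonneg (α := ℝ)
        linarith
      exact ((differentiableAt_const _).sub ((differentiableAt_const _).div
        (by fun_prop) this)).differentiableWithinAt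
    · refine (norm_digamma_term_le hw.1 n).trans ?_
      have := (mem_ball_zero_iff.1 hw.2).le
      gcongr
  have hG : ∀ w ∈ U, ∀ m : ℕ, w ≠ -m := by
    intro w hw m h
    have h3 : 0 < w.re := hw.1
    rw [h] at h3
    simp at h3
    have := m.cast_nonneg (α := ℝ)
    linarith
  have hd2 : DifferentiableOn ℂ
      (fun w ↦ Complex.digamma w + 1 / w + Real.eulerMascheroniConstant) U := by
    have hΓ : DifferentiableOn ℂ Complex.Gamma U := fun w hw ↦
      (Complex.differentiableAt_Gamma w (hG w hw)).differentiableWithinAt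
    refine DifferentiableOn.add_const _ (DifferentiableOn.add ?_ ?_)
    · exact (hΓ.deriv hUo).div hΓ fun w hw ↦ Complex.Gamma_ne_zero (hG w hw)
    · exact DifferentiableOn.div (differentiableOn_const _) differentiableOn_id
        fun w hw ↦ by simpa using hG w hw 0
  have hRpos : 0 < R := by positivity
  have h0 : ((R / 2 : ℝ) : ℂ) ∈ U := by
    constructor
    · simpa using hRpos
    · rw [mem_ball_zero_iff, Complex.norm_real, Real.norm_of_nonneg (by positivity)]
      linarith
  have hfreq : ∃ᶠ w in 𝓝[≠] ((R / 2 : ℝ) : ℂ),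
      ∑' n : ℕ, (1 / (n + 1 : ℂ) - 1 / (n + 1 + w)) =
        Complex.digamma w + 1 / w + Real.eulerMascheroniConstant := by
    have ht : Tendsto (fun x : ℝ ↦ (x : ℂ)) (𝓝[≠] (R / 2)) (𝓝[≠] ((R / 2 : ℝ) : ℂ)) :=
      Complex.continuous_ofReal.continuousWithinAt.tendsto_nhdsWithin
        fun x hx ↦ fun h ↦ hx (Complex.ofReal_injective h)
    refine ht.frequently (Eventually.frequently ?_)
    filter_upwards [nhdsWithin_le_nhds (eventually_gt_nhds (by positivity : 0 < R / 2))] with x hx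
    exact (hreal hx).tsum_eq
  have key := (hd1.analyticOnNhd hUo).eqOn_of_preconnected_of_frequently_eq
    (hd2.analyticOnNhd hUo) hUc.isPreconnected h0 hfreq
  have hzU : z ∈ U := ⟨hz, by rw [mem_ball_zero_iff]; linarith⟩
  have hs := (summable_digamma_term hz).hasSum
  have hkey : ∑' n : ℕ, (1 / (n + 1 : ℂ) - 1 / (n + 1 + z)) =
      Complex.digamma z + 1 / z + Real.eulerMascheroniConstant := key hzU
  rwa [hkey] at hs

/-- `∑ 1 / (2n (2n + 1)) = 1 - log 2`. -/
lemma hasSum_one_div_two_mul_mul :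
    HasSum (fun n : ℕ ↦ 1 / ((2 * (n + 1)) * (2 * (n + 1) + 1) : ℂ)) (1 - Real.log 2) := by
  -- The digamma series at `1/2`, with `ψ(1/2) = -2 log 2 - γ`.
  have h := (hasSum_digamma (z := 1 / 2) (by norm_num)).mul_left (1 / 2)
  rw [Complex.digamma_one_half] at h
  have hterm : ∀ n : ℕ, (1 / 2 : ℂ) * (1 / (n + 1) - 1 / (n + 1 + 1 / 2)) =
      1 / ((2 * (n + 1)) * (2 * (n + 1) + 1)) := by
    intro n
    have h1 : (n + 1 : ℂ) ≠ 0 := by exact_mod_cast n.succ_ne_zero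
    have h2 : (2 * (n + 1) + 1 : ℂ) ≠ 0 := by exact_mod_cast (2 * (n + 1)).succ_ne_zero
    have h3 : (n + 1 + 1 / 2 : ℂ) = (2 * (n + 1) + 1) / 2 := by ring
    rw [h3]
    field_simp
    ring
  simp only [hterm] at h
  have h4 : (1 - Real.log 2 : ℂ) = 1 / 2 * (-2 * Complex.log 2 -
      Real.eulerMascheroniConstant + 1 / (1 / 2) + Real.eulerMascheroniConstant) := by
    rw [Complex.ofReal_log (by norm_num)]
    push_cast
    ring
  rw [h4]
  exact h

end Digamma

end

section

open Filter Topology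

/-! ### The logarithmic derivative of xi -/

lemma logDeriv_Gammaℝ {s : ℂ} (hs : 0 < s.re) :
    logDeriv Complex.Gammaℝ s = -(Real.log Real.pi / 2) + Complex.digamma (s / 2) / 2 := by
  have hπ : (Real.pi : ℂ) ≠ 0 := by exact_mod_cast Real.pi_ne_zero
  have hG : ∀ m : ℕ, s / 2 ≠ -m := by
    intro m h
    have h2 := congr_arg Complex.re h
    simp at h2
    have := m.cast_nonneg (α := ℝ)
    linarith
  have hΓ := Complex.differentiableAt_Gamma _ hG
  have hexp : HasDerivAt (fun s : ℂ ↦ (Real.pi : ℂ) ^ (-s / 2))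
      ((Real.pi : ℂ) ^ (-s / 2) * Complex.log Real.pi * (-1 / 2)) s :=
    HasDerivAt.const_cpow ((hasDerivAt_id s).neg.div_const 2) (Or.inl hπ)
  have hhalf : HasDerivAt (fun s : ℂ ↦ s / 2) (1 / 2) s := (hasDerivAt_id s).div_const 2
  have hcomp : HasDerivAt (fun s : ℂ ↦ Complex.Gamma (s / 2))
      (deriv Complex.Gamma (s / 2) * (1 / 2)) s := hΓ.hasDerivAt.comp s hhalf
  have hp0 : (Real.pi : ℂ) ^ (-s / 2) ≠ 0 := by simp [Complex.cpow_eq_zero_iff, hπ]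
  have hdef : Complex.Gammaℝ = fun s : ℂ ↦ (Real.pi : ℂ) ^ (-s / 2) * Complex.Gamma (s / 2) :=
    funext Complex.Gammaℝ_def
  rw [hdef, logDeriv_mul (f := fun s : ℂ ↦ (Real.pi : ℂ) ^ (-s / 2))
    (g := fun s : ℂ ↦ Complex.Gamma (s / 2)) s hp0 (Complex.Gamma_ne_zero hG) hexp.differentiableAt
    hcomp.differentiableAt, logDeriv_apply, logDeriv_apply, hexp.deriv, hcomp.deriv,
    Complex.digamma_def, logDeriv_apply, Complex.ofReal_log Real.pi_pos.le]
  field_simp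

lemma logDeriv_entireXi {s : ℂ} (hs : 1 < s.re) :
    logDeriv entireXi s = 1 / s + 1 / (s - 1) + logDeriv Complex.Gammaℝ s +
      deriv riemannZeta s / riemannZeta s := by
  have hs1 : s ≠ 1 := by rintro rfl; norm_num at hs
  have hs0 : s ≠ 0 := by rintro rfl; norm_num at hs
  have hs1' : s - 1 ≠ 0 := sub_ne_zero.2 hs1
  have heq : entireXi =ᶠ[𝓝 s] fun s ↦ s * (s - 1) * s.Gammaℝ * riemannZeta s := by
    filter_upwards [(isOpen_lt continuous_const Complex.continuous_re).mem_nhds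
      (show (0 : ℝ) < s.re by linarith), isOpen_ne.mem_nhds hs1] with z hz hz1
    exact entireXi_eq_of_re_pos hz hz1
  have hΓ := differentiableAt_Gammaℝ (s := s) (by linarith)
  have hΓ0 := Complex.Gammaℝ_ne_zero_of_re_pos (s := s) (by linarith)
  have hz := differentiableAt_riemannZeta hs1
  have hz0 := riemannZeta_ne_zero_of_one_le_re hs.le
  rw [logDeriv_apply, heq.deriv_eq, heq.eq_of_nhds, ← logDeriv_apply,
    logDeriv_mul (f := fun s : ℂ ↦ s * (s - 1) * s.Gammaℝ) s
      (mul_ne_zero (mul_ne_zero hs0 hs1') hΓ0) hz0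
      ((by fun_prop : DifferentiableAt ℂ (fun s : ℂ ↦ s * (s - 1)) s).mul hΓ) hz,
    logDeriv_mul (f := fun s : ℂ ↦ s * (s - 1)) s (mul_ne_zero hs0 hs1') hΓ0 (by fun_prop) hΓ,
    logDeriv_mul (f := fun s : ℂ ↦ s) (g := fun s : ℂ ↦ s - 1) s hs0 hs1' (by fun_prop) (by fun_prop), logDeriv_apply riemannZeta]
  simp [logDeriv_apply]

/-- Used at `0` and `1`, where `s (s - 1)` kills the unknown derivative of `Λ₀`. -/
lemma hasDerivAt_entireXi (s : ℂ) :
    HasDerivAt entireXi ((2 * s - 1) * completedRiemannZeta₀ s +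
      s * (s - 1) * deriv completedRiemannZeta₀ s) s := by
  have h1 : HasDerivAt (fun s : ℂ ↦ s * (s - 1)) (2 * s - 1) s := by
    refine ((hasDerivAt_id s).fun_mul ((hasDerivAt_id s).sub_const 1)).congr_deriv ?_
    simp; ring
  exact (h1.fun_mul (differentiable_completedZeta₀ s).hasDerivAt).add_const 1

/-- The Mellin transform of the sum over zeros, in terms of `ζ' / ζ`. -/
theorem hasSum_zeros_div {s : ℂ} (hs : 1 < s.re) :
    HasSum (fun ρ : nontrivialZetaZeros ↦ (analyticOrderNatAt riemannZeta ρ : ℂ) *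
        (1 / ((ρ : ℂ) * (1 - ρ)) * (1 / (s - ρ))))
      (-deriv riemannZeta s / riemannZeta s * (1 / (s - 1) - 1 / s) - 1 / (s - 1) ^ 2 +
        (Real.eulerMascheroniConstant + 1) * (1 / (s - 1)) - Real.log (2 * Real.pi) * (1 / s) +
        ∑' n : ℕ, 1 / ((2 * (n + 1)) * (2 * (n + 1) + 1)) * (1 / (s + 2 * (n + 1)))) := by
  obtain ⟨C, hC, hfC⟩ := exists_norm_entireXi_le
  have hs1 : s ≠ 1 := by rintro rfl; norm_num at hs
  have hs0 : s ≠ 0 := by rintro rfl; norm_num at hs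
  have hs1' : s - 1 ≠ 0 := sub_ne_zero.2 hs1
  have hpf {z : ℂ} (hz : 1 ≤ z.re) : HasSum (fun ρ : nontrivialZetaZeros ↦
      (analyticOrderNatAt riemannZeta ρ : ℂ) * (1 / (z - ρ) + 1 / (ρ : ℂ)))
      (logDeriv entireXi z - logDeriv entireXi 0) := by
    have h := differentiable_entireXi.hasSum_logDeriv_sub entireXi_zero hC hfC
      (entireXi_ne_zero_of_one_le_re hz)
    rw [setOf_entireXi_eq_zero] at h
    refine h.congr_fun fun ρ ↦ ?_
    rw [analyticOrderNatAt_entireXi ρ.2]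
  set c : ℂ := completedRiemannZeta₀ 0 with hc
  have hcv : c = (Real.eulerMascheroniConstant - (2 * Real.log 2 + Real.log Real.pi)) / 2 + 1 := by
    rw [hc, completedRiemannZeta₀_zero]
    have h4 : Complex.log (4 * Real.pi) = 2 * Real.log 2 + Real.log Real.pi := by
      have h5 : (4 * Real.pi : ℂ) = ((4 * Real.pi : ℝ) : ℂ) := by push_cast; rfl
      rw [h5, ← Complex.ofReal_log (by positivity),
        Real.log_mul (by norm_num) Real.pi_ne_zero,
        show (4 : ℝ) = 2 ^ 2 by norm_num, Real.log_pow]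
      push_cast
      ring
    rw [h4]
  -- The functional equation equates the values at `0` and `1`, so the logarithmic derivatives there
  -- are `-c` and `c`.
  have hc1 : completedRiemannZeta₀ 1 = c := by
    rw [← completedRiemannZeta₀_one_sub]; simp [hc]
  have hL0 : logDeriv entireXi 0 = -c := by
    rw [logDeriv_apply, (hasDerivAt_entireXi 0).deriv, entireXi_zero]
    simp [hc]
  have hL1 : logDeriv entireXi 1 = c := by
    rw [logDeriv_apply, (hasDerivAt_entireXi 1).deriv, entireXi_one, hc1]
    norm_num
  have hA := hpf hs.le
  have hB := hpf (z := 1) (by simp)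
  rw [hL0, hL1] at hB
  rw [hL0, logDeriv_entireXi hs, logDeriv_Gammaℝ (by linarith)] at hA
  have hD := hasSum_digamma (z := s / 2) (by simp; linarith)
  -- With `k = n + 1`, each term splits as `1/(s-1) · 1/(2k(2k+1))` minus `1/(2s(s-1)) · (1/k - 1/(k
  -- + s/2))`: the series for `1 - log 2` and for `ψ(s/2)`.
  have hE : HasSum (fun n : ℕ ↦
      1 / ((2 * (n + 1)) * (2 * (n + 1) + 1) : ℂ) * (1 / (s + 2 * (n + 1)))) _ :=
    ((hasSum_one_div_two_mul_mul.mul_left (1 / (s - 1))).sub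
      (hD.mul_left (1 / (s * (s - 1)) * (1 / 2)))).congr_fun fun n ↦ by
    have h1 : (n + 1 : ℂ) ≠ 0 := by exact_mod_cast n.succ_ne_zero
    have h2 : (2 * (n + 1) + 1 : ℂ) ≠ 0 := by exact_mod_cast (2 * (n + 1)).succ_ne_zero
    have h3 : s + 2 * (n + 1) ≠ 0 := by
      intro h
      have h2 := congr_arg Complex.re h
      simp at h2
      have := n.cast_nonneg (α := ℝ)
      linarith
    have h4 : (n + 1 + s / 2 : ℂ) = (s + 2 * (n + 1)) / 2 := by ring
    rw [h4]
    field_simp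
    ring
  rw [hE.tsum_eq]
  have hT := (hA.mul_left (-(1 / (s * (s - 1))))).add (hB.mul_left (1 / (s - 1)))
  -- Partial fractions express the desired term through those of the expansion of `ξ'/ξ` at `s` and
  -- at `1`.
  have hfun : ∀ ρ : nontrivialZetaZeros, (analyticOrderNatAt riemannZeta ρ : ℂ) *
        (1 / ((ρ : ℂ) * (1 - ρ)) * (1 / (s - ρ))) =
      -(1 / (s * (s - 1))) *
        ((analyticOrderNatAt riemannZeta ρ : ℂ) * (1 / (s - ρ) + 1 / (ρ : ℂ))) +
      1 / (s - 1) *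
        ((analyticOrderNatAt riemannZeta ρ : ℂ) * (1 / (1 - ρ) + 1 / (ρ : ℂ))) := by
    rintro ⟨ρ, h0, h1, -⟩
    have hρ0 : ρ ≠ 0 := by rintro rfl; simp at h0
    have hρ1 : 1 - ρ ≠ 0 := by
      rw [sub_ne_zero]; rintro rfl; simp at h1
    have hsρ : s - ρ ≠ 0 := by
      rw [sub_ne_zero]; rintro rfl; linarith
    field_simp
    ring
  have hval : -deriv riemannZeta s / riemannZeta s * (1 / (s - 1) - 1 / s) - 1 / (s - 1) ^ 2 +
        (Real.eulerMascheroniConstant + 1) * (1 / (s - 1)) - Real.log (2 * Real.pi) * (1 / s) +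
        (1 / (s - 1) * (1 - Real.log 2) - 1 / (s * (s - 1)) * (1 / 2) *
          (Complex.digamma (s / 2) + 1 / (s / 2) + Real.eulerMascheroniConstant)) =
      -(1 / (s * (s - 1))) * (1 / s + 1 / (s - 1) +
        (-(Real.log Real.pi / 2) + Complex.digamma (s / 2) / 2) +
        deriv riemannZeta s / riemannZeta s - -c) + 1 / (s - 1) * (c - -c) := by
    rw [hcv, Real.log_mul (by norm_num) Real.pi_ne_zero]
    have hz0 := riemannZeta_ne_zero_of_one_le_re hs.le
    push_cast
    field_simp
    ring
  rw [hval]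
  exact hT.congr_fun fun ρ ↦ hfun ρ

end

section

open Filter Topology MeasureTheory Set

/-! ### Mellin transforms on `(1, ∞)` -/

/-- `v` is the value of the convergent integral `∫₁^∞ x ^ (-s - 1) f(x) dx`. -/
def HasMellinIoi (f : ℝ → ℂ) (s v : ℂ) : Prop :=
  IntegrableOn (fun x : ℝ ↦ (x : ℂ) ^ (-s - 1) * f x) (Ioi 1) ∧
    ∫ x in Ioi (1 : ℝ), (x : ℂ) ^ (-s - 1) * f x = v

namespace HasMellinIoi

variable {f g : ℝ → ℂ} {s v w : ℂ}

lemma congr (hf : HasMellinIoi f s v) (h : ∀ x, 1 < x → f x = g x) : HasMellinIoi g s v := by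
  have h' : EqOn (fun x : ℝ ↦ (x : ℂ) ^ (-s - 1) * f x) (fun x : ℝ ↦ (x : ℂ) ^ (-s - 1) * g x)
      (Ioi 1) := fun x hx ↦ by simp only [h x hx]
  exact ⟨hf.1.congr_fun h' measurableSet_Ioi,
    (setIntegral_congr_fun measurableSet_Ioi h').symm.trans hf.2⟩

lemma add (hf : HasMellinIoi f s v) (hg : HasMellinIoi g s w) :
    HasMellinIoi (fun x ↦ f x + g x) s (v + w) := by
  refine ⟨?_, ?_⟩
  · simp only [mul_add]; exact hf.1.add hg.1
  · simp only [mul_add]; rw [integral_add hf.1 hg.1, hf.2, hg.2]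

lemma const_mul (hf : HasMellinIoi f s v) (c : ℂ) : HasMellinIoi (fun x ↦ c * f x) s (c * v) := by
  refine ⟨?_, ?_⟩
  · simp only [mul_left_comm _ c]; exact hf.1.const_mul c
  · simp only [mul_left_comm _ c]; rw [integral_const_mul, hf.2]

lemma sub (hf : HasMellinIoi f s v) (hg : HasMellinIoi g s w) :
    HasMellinIoi (fun x ↦ f x - g x) s (v - w) := by
  have := hf.add (hg.const_mul (-1))
  rw [neg_one_mul, ← sub_eq_add_neg] at this
  exact this.congr fun x _ ↦ by ring

end HasMellinIoi

lemma hasMellinIoi_cpow {s w : ℂ} (h : w.re < s.re) :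
    HasMellinIoi (fun x ↦ (x : ℂ) ^ w) s (1 / (s - w)) := by
  have h0 : s - w ≠ 0 := by
    intro h0
    have := congr_arg Complex.re h0
    simp at this
    linarith
  have hre : (w - s - 1).re < -1 := by simp; linarith
  have heq : EqOn (fun x : ℝ ↦ (x : ℂ) ^ (w - s - 1)) (fun x : ℝ ↦ (x : ℂ) ^ (-s - 1) * (x : ℂ) ^ w)
      (Ioi 1) := fun x hx ↦ by
    have hx0 : (x : ℂ) ≠ 0 := by
      have : (0 : ℝ) < x := zero_lt_one.trans hx
      exact_mod_cast this.ne'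
    simp only [← Complex.cpow_add _ _ hx0]
    ring_nf
  refine ⟨(integrableOn_Ioi_cpow_of_lt hre one_pos).congr_fun heq measurableSet_Ioi, ?_⟩
  rw [← setIntegral_congr_fun measurableSet_Ioi heq, integral_Ioi_cpow_of_lt hre one_pos,
    Complex.ofReal_one, Complex.one_cpow]
  rw [show w - s - 1 + 1 = -(s - w) by ring, neg_div_neg_eq]

lemma norm_cpow_neg_sub_one {x : ℝ} (hx : 0 < x) (s : ℂ) :
    ‖(x : ℂ) ^ (-s - 1)‖ = x ^ (-s.re - 1) := by
  rw [Complex.norm_cpow_eq_rpow_re_of_pos hx]; simp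

section Series

variable {ι : Type*} {u : ι → ℝ → ℂ} {b : ι → ℝ}

/-- A series dominated by `x ^ (3 / 2)` is continuous on `(1, ∞)`. -/
lemma continuousOn_tsum_of_norm_le_rpow (hu : ∀ i, ContinuousOn (u i) (Ioi 1)) (hb : Summable b)
    (hb0 : ∀ i, 0 ≤ b i) (hub : ∀ i x, 1 < x → ‖u i x‖ ≤ b i * x ^ (3 / 2 : ℝ)) :
    ContinuousOn (fun x ↦ ∑' i, u i x) (Ioi 1) := by
  refine isOpen_Ioi.continuousOn_iff.2 fun x hx ↦ ?_
  rw [mem_Ioi] at hx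
  have hlt : x < x + 1 := by linarith
  -- On `(1, x + 1)` the majorant is uniform, so the Weierstrass test applies.
  refine ContinuousOn.continuousAt (s := Ioo 1 (x + 1)) ?_ (Ioo_mem_nhds hx hlt)
  refine continuousOn_tsum (fun i ↦ (hu i).mono Ioo_subset_Ioi_self)
    (hb.mul_right ((x + 1) ^ (3 / 2 : ℝ))) fun i y hy ↦ (hub i y hy.1).trans ?_
  have := hy.1
  have := hb0 i
  gcongr
  exact hy.2.le

/-- Termwise Mellin transform of a series dominated by `x ^ (3 / 2)`. -/
lemma hasMellinIoi_tsum [Countable ι] (hu : ∀ i, ContinuousOn (u i) (Ioi 1)) (hb : Summable b)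
    (hb0 : ∀ i, 0 ≤ b i) (hub : ∀ i x, 1 < x → ‖u i x‖ ≤ b i * x ^ (3 / 2 : ℝ))
    {s : ℂ} (hs : s.re = 2) {v : ι → ℂ} (hv : ∀ i, HasMellinIoi (u i) s (v i)) :
    HasMellinIoi (fun x ↦ ∑' i, u i x) s (∑' i, v i) := by
  have hw : ContinuousOn (fun x : ℝ ↦ (x : ℂ) ^ (-s - 1)) (Ioi 1) := by
    refine ContinuousOn.cpow_const Complex.continuous_ofReal.continuousOn fun x hx ↦ ?_
    exact Complex.ofReal_mem_slitPlane.2 (zero_lt_one.trans hx)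
  -- On `Re s = 2` the kernel has size `x^(-3)`, leaving the integrable majorant `x^(-3/2)`. The
  -- exponent `3/2` must stay below `2` here; the prime sum will require it to exceed `1`.
  have hbound : ∀ i, ∀ x : ℝ, 1 < x → ‖(x : ℂ) ^ (-s - 1) * u i x‖ ≤ b i * x ^ (-(3 / 2) : ℝ) := by
    intro i x hx
    have hx0 : 0 < x := by linarith
    rw [norm_mul, norm_cpow_neg_sub_one hx0, hs]
    calc x ^ (-2 - 1 : ℝ) * ‖u i x‖ ≤ x ^ (-2 - 1 : ℝ) * (b i * x ^ (3 / 2 : ℝ)) := by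
          gcongr; exact hub i x hx
      _ = b i * (x ^ (-2 - 1 : ℝ) * x ^ (3 / 2 : ℝ)) := by ring
      _ = _ := by rw [← Real.rpow_add hx0]; norm_num
  have hint : IntegrableOn (fun x : ℝ ↦ (∑' i, b i) * x ^ (-(3 / 2) : ℝ)) (Ioi 1) :=
    (integrableOn_Ioi_rpow_of_lt (by norm_num) one_pos).const_mul _
  have hsum : ∀ x : ℝ, 1 < x → Summable fun i ↦ b i * x ^ (-(3 / 2) : ℝ) := fun x _ ↦ hb.mul_right _
  have hF : ∀ x : ℝ, 1 < x → HasSum (fun i ↦ (x : ℂ) ^ (-s - 1) * u i x)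
      ((x : ℂ) ^ (-s - 1) * ∑' i, u i x) := by
    intro x hx
    exact (Summable.of_norm_bounded (hb.mul_right _) fun i ↦ hub i x hx).hasSum.mul_left _
  have key := hasSum_integral_of_dominated_convergence (μ := volume.restrict (Ioi (1 : ℝ)))
    (F := fun i x ↦ (x : ℂ) ^ (-s - 1) * u i x) (f := fun x ↦ (x : ℂ) ^ (-s - 1) * ∑' i, u i x)
    (fun i x ↦ b i * x ^ (-(3 / 2) : ℝ)) (fun i ↦ (hv i).1.aestronglyMeasurable)
    (fun i ↦ (ae_restrict_mem measurableSet_Ioi).mono fun x hx ↦ hbound i x hx)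
    ((ae_restrict_mem measurableSet_Ioi).mono fun x hx ↦ hsum x hx)
    (by simp only [tsum_mul_right]; exact hint)
    ((ae_restrict_mem measurableSet_Ioi).mono fun x hx ↦ hF x hx)
  refine ⟨?_, ?_⟩
  · refine Integrable.mono' hint ?_ ?_
    · exact (hw.mul (continuousOn_tsum_of_norm_le_rpow hu hb hb0 hub)).aestronglyMeasurable
        measurableSet_Ioi
    · refine (ae_restrict_mem measurableSet_Ioi).mono fun x hx ↦ ?_
      rw [← (hF x hx).tsum_eq, ← tsum_mul_right]
      exact tsum_of_norm_bounded (hsum x hx).hasSum fun i ↦ hbound i x hx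
  · simp only [(hv _).2] at key
    exact key.tsum_eq.symm

end Series

/-- The Mellin transform of `max (x / n - 1) 0`. -/
lemma hasMellinIoi_max {s : ℂ} (hs : 1 < s.re) {n : ℕ} (hn : n ≠ 0) :
    HasMellinIoi (fun x ↦ (max (x / n - 1) 0 : ℝ)) s
      ((n : ℂ) ^ (-s) * (1 / (s - 1) - 1 / s)) := by
  have hn1 : (1 : ℝ) ≤ n := by exact_mod_cast Nat.one_le_iff_ne_zero.2 hn
  have hn0 : (0 : ℝ) < n := by linarith
  have hnc : (n : ℂ) ≠ 0 := by exact_mod_cast hn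
  have hs1 : s - 1 ≠ 0 := sub_ne_zero.2 (by rintro rfl; norm_num at hs)
  have hs0 : s ≠ 0 := by rintro rfl; norm_num at hs
  have hre1 : (-s).re < -1 := by simpa using hs
  have hre2 : (-s - 1).re < -1 := by simp; linarith
  -- The integrand vanishes up to `n` and equals `g` beyond.
  set g : ℝ → ℂ := fun x ↦ (x : ℂ) ^ (-s) * (n : ℂ)⁻¹ - (x : ℂ) ^ (-s - 1) with hg
  have hi1 := (integrableOn_Ioi_cpow_of_lt hre1 hn0).mul_const (n : ℂ)⁻¹
  have hi2 := integrableOn_Ioi_cpow_of_lt hre2 hn0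
  have heq : EqOn ((Ioi (n : ℝ)).indicator g)
      (fun x : ℝ ↦ (x : ℂ) ^ (-s - 1) * ((max (x / n - 1) 0 : ℝ) : ℂ)) (Ioi 1) := by
    intro x hx
    have hx0 : (0 : ℝ) < x := zero_lt_one.trans hx
    have hxc : (x : ℂ) ≠ 0 := by exact_mod_cast hx0.ne'
    by_cases hxn : x ∈ Ioi (n : ℝ)
    · have h1 : 1 ≤ x / n := (one_le_div hn0).2 (le_of_lt hxn)
      rw [indicator_of_mem hxn]
      simp only [hg]
      rw [max_eq_left (by linarith), Complex.cpow_sub _ _ hxc, Complex.cpow_one]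
      push_cast
      field_simp
    · have h1 : x / n ≤ 1 := (div_le_one hn0).2 (not_lt.1 hxn)
      rw [indicator_of_notMem hxn]
      simp only []
      rw [max_eq_right (by linarith), Complex.ofReal_zero, mul_zero]
  have hsub : Ioi (1 : ℝ) ∩ Ioi (n : ℝ) = Ioi (n : ℝ) := by
    rw [Ioi_inter_Ioi, max_eq_right hn1]
  refine ⟨IntegrableOn.congr_fun ?_ heq measurableSet_Ioi, ?_⟩
  · exact ((integrable_indicator_iff measurableSet_Ioi).2 (hi1.sub hi2)).integrableOn
  · rw [← setIntegral_congr_fun measurableSet_Ioi heq, setIntegral_indicator measurableSet_Ioi,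
      hsub, hg, integral_sub hi1 hi2, integral_mul_const, integral_Ioi_cpow_of_lt hre1 hn0,
      integral_Ioi_cpow_of_lt hre2 hn0, sub_add_cancel, Complex.cpow_add _ _ (by exact_mod_cast hnc),
      Complex.cpow_one, Complex.ofReal_natCast]
    have : -s + 1 ≠ 0 := by rw [neg_add_eq_sub, ← neg_sub]; exact neg_ne_zero.2 hs1
    field_simp
    ring

/-- The Mellin transform of `x log x`. -/
lemma hasMellinIoi_mul_log {s : ℂ} (hs : s.re = 2) :
    HasMellinIoi (fun x ↦ (x * Real.log x : ℝ)) s (1 / (s - 1) ^ 2) := by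
  have hs1 : 1 - s ≠ 0 := by
    intro h
    have := congr_arg Complex.re h
    simp [hs] at this
    norm_num at this
  have hcontw (w : ℂ) : ContinuousOn (fun x : ℝ ↦ (x : ℂ) ^ w) (Ioi 1) :=
    ContinuousOn.cpow_const Complex.continuous_ofReal.continuousOn fun x hx ↦
      Complex.ofReal_mem_slitPlane.2 (zero_lt_one.trans hx)
  have hint : IntegrableOn (fun x : ℝ ↦ (x : ℂ) ^ (-s) * (Real.log x : ℂ)) (Ioi 1) := by
    refine Integrable.mono' ((integrableOn_Ioi_rpow_of_lt
      (by norm_num : (-(3 / 2) : ℝ) < -1) one_pos).const_mul 2) ?_ ?_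
    · refine ((hcontw _).mul (Complex.continuous_ofReal.comp_continuousOn
        (Real.continuousOn_log.mono fun x hx ↦ ?_))).aestronglyMeasurable measurableSet_Ioi
      exact (zero_lt_one.trans hx).ne'
    · refine (ae_restrict_mem measurableSet_Ioi).mono fun x hx ↦ ?_
      have hx0 : (0 : ℝ) < x := zero_lt_one.trans hx
      rw [norm_mul, Complex.norm_cpow_eq_rpow_re_of_pos hx0, Complex.norm_real,
        Real.norm_of_nonneg (Real.log_nonneg (le_of_lt hx)), Complex.neg_re, hs]
      calc x ^ (-2 : ℝ) * Real.log x ≤ x ^ (-2 : ℝ) * (x ^ (1 / 2 : ℝ) / (1 / 2)) := by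
            gcongr
            exact Real.log_le_rpow_div hx0.le (by norm_num)
        _ = 2 * (x ^ (-2 : ℝ) * x ^ (1 / 2 : ℝ)) := by ring
        _ = _ := by rw [← Real.rpow_add hx0]; norm_num
  -- An antiderivative of `x^(-s) log x`; it tends to `0` at infinity, so the integral is `-Φ(1)`.
  set Φ : ℝ → ℂ := fun x ↦ (x : ℂ) ^ (1 - s) * ((Real.log x : ℂ) / (1 - s) - 1 / (1 - s) ^ 2)
    with hΦ
  have hderiv : ∀ x ∈ Ici (1 : ℝ), HasDerivAt Φ ((x : ℂ) ^ (-s) * (Real.log x : ℂ)) x := by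
    intro x hx
    have hx0 : (0 : ℝ) < x := zero_lt_one.trans_le hx
    have hxc : (x : ℂ) ≠ 0 := by exact_mod_cast hx0.ne'
    have h1 : HasDerivAt (fun x : ℝ ↦ (x : ℂ) ^ (1 - s)) ((1 - s) * (x : ℂ) ^ (1 - s - 1)) x := by
      have := (hasDerivAt_id (x : ℂ)).cpow_const (c := 1 - s) (Complex.ofReal_mem_slitPlane.2 hx0)
      simpa using this.comp_ofReal
    have h2 : HasDerivAt (fun x : ℝ ↦ (Real.log x : ℂ) / (1 - s) - 1 / (1 - s) ^ 2)
        ((x⁻¹ : ℝ) / (1 - s)) x :=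
      (((Real.hasDerivAt_log hx0.ne').ofReal_comp).div_const _).sub_const _
    refine (h1.fun_mul h2).congr_deriv ?_
    have h3 : (x : ℂ) ^ (1 - s) = (x : ℂ) ^ (-s) * x := by
      rw [show 1 - s = -s + 1 by ring, Complex.cpow_add _ _ hxc, Complex.cpow_one]
    rw [show 1 - s - 1 = -s by ring, h3]
    push_cast
    field_simp
    ring
  have hlim : Tendsto Φ atTop (𝓝 0) := by
    rw [tendsto_zero_iff_norm_tendsto_zero]
    have h1 : Tendsto (fun x : ℝ ↦ Real.log x / x) atTop (𝓝 0) := by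
      have := (isLittleO_log_rpow_atTop one_pos).tendsto_div_nhds_zero
      simpa using this
    have h2 := (h1.mul_const (1 / ‖1 - s‖)).add
      (tendsto_inv_atTop_zero.mul_const (1 / ‖1 - s‖ ^ 2))
    rw [zero_mul, zero_mul, add_zero] at h2
    refine squeeze_zero' (Eventually.of_forall fun _ ↦ norm_nonneg _) ?_ h2
    filter_upwards [eventually_gt_atTop 1] with x hx
    have hx0 : (0 : ℝ) < x := by linarith
    rw [hΦ]
    simp only []
    rw [norm_mul, Complex.norm_cpow_eq_rpow_re_of_pos hx0, Complex.sub_re, Complex.one_re, hs]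
    have h3 : x ^ (1 - 2 : ℝ) = x⁻¹ := by
      rw [← Real.rpow_neg_one]; norm_num
    rw [h3]
    calc _ ≤ x⁻¹ * (‖(Real.log x : ℂ) / (1 - s)‖ + ‖1 / (1 - s) ^ 2‖) := by
          gcongr; exact norm_sub_le _ _
      _ = _ := by
          rw [norm_div, norm_div, norm_one, norm_pow, Complex.norm_real,
            Real.norm_of_nonneg (Real.log_nonneg hx.le)]
          ring
  have heq : EqOn (fun x : ℝ ↦ (x : ℂ) ^ (-s) * (Real.log x : ℂ))
      (fun x : ℝ ↦ (x : ℂ) ^ (-s - 1) * ((x * Real.log x : ℝ) : ℂ)) (Ioi 1) := by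
    intro x hx
    have hxc : (x : ℂ) ≠ 0 := by exact_mod_cast (zero_lt_one.trans hx).ne'
    simp only [Complex.cpow_sub _ _ hxc, Complex.cpow_one]
    push_cast
    field_simp
  refine ⟨hint.congr_fun heq measurableSet_Ioi, ?_⟩
  rw [← setIntegral_congr_fun measurableSet_Ioi heq,
    integral_Ioi_of_hasDerivAt_of_tendsto' hderiv hint hlim, hΦ]
  simp only [Complex.ofReal_one, Complex.one_cpow, Real.log_one, Complex.ofReal_zero, zero_div]
  rw [← neg_sub 1 s, neg_sq]
  ring

/-- A function with vanishing Mellin transform on a vertical line vanishes where it is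
continuous. -/
lemma eq_zero_of_hasMellinIoi_zero {f : ℝ → ℂ} (hf : ContinuousOn f (Ioi 1))
    (hm : ∀ s : ℂ, s.re = 2 → HasMellinIoi f s 0) {x : ℝ} (hx : 1 < x) : f x = 0 := by
  -- After extension by zero the transform at `s` is the usual Mellin transform at `-s`, so the line
  -- `Re s = 2` becomes `Re = -2`.
  set g := (Ioi (1 : ℝ)).indicator f
  have hker (s : ℂ) : (fun t : ℝ ↦ (t : ℂ) ^ (-s - 1) • g t) =
      (Ioi (1 : ℝ)).indicator fun t ↦ (t : ℂ) ^ (-s - 1) * f t := by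
    ext t
    by_cases ht : t ∈ Ioi (1 : ℝ) <;> simp [g, ht]
  have hsub : Ioi (0 : ℝ) ∩ Ioi 1 = Ioi 1 := by
    rw [Ioi_inter_Ioi, max_eq_right zero_le_one]
  have hconv : MellinConvergent g ((-2 : ℝ) : ℂ) := by
    have h := hm 2 (by simp)
    have h1 : ((-2 : ℝ) : ℂ) - 1 = -2 - 1 := by norm_num
    rw [MellinConvergent, h1, hker]
    exact ((integrable_indicator_iff measurableSet_Ioi).2 h.1).integrableOn
  have hzero (y : ℝ) : mellin g ((-2 : ℝ) + y * Complex.I) = 0 := by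
    have h := hm (-((-2 : ℝ) + y * Complex.I)) (by simp)
    have h2 := hker (-((-2 : ℝ) + y * Complex.I))
    rw [neg_neg] at h2
    rw [mellin, h2, setIntegral_indicator measurableSet_Ioi, hsub]
    simpa using h.2
  have hvert : Complex.VerticalIntegrable (mellin g) (-2) := by
    simp only [Complex.VerticalIntegrable, hzero]
    exact integrable_zero _ _ _
  have heq : g =ᶠ[𝓝 x] f := by
    filter_upwards [Ioi_mem_nhds hx] with t ht using indicator_of_mem ht f
  have hcont : ContinuousAt g x := (hf.continuousAt (Ioi_mem_nhds hx)).congr heq.symm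
  have := mellinInv_mellin_eq (-2) g (by linarith) hconv hvert hcont
  rw [mellinInv] at this
  simp only [hzero, smul_zero, integral_zero] at this
  rw [heq.eq_of_nhds] at this
  exact this.symm

end

section

open Filter Topology MeasureTheory Set

/-! ### The explicit formula -/

lemma ne_zero_of_mem_nontrivialZetaZeros {ρ : ℂ} (hρ : ρ ∈ nontrivialZetaZeros) : ρ ≠ 0 := by
  rintro rfl
  simpa using hρ.1

lemma one_sub_ne_zero_of_mem_nontrivialZetaZeros {ρ : ℂ} (hρ : ρ ∈ nontrivialZetaZeros) :
    1 - ρ ≠ 0 := by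
  intro h
  rw [sub_eq_zero] at h
  simpa [← h] using hρ.2.1

/-- Each disc holds finitely many zeros. Countability is needed to integrate the zero sum termwise.
-/
lemma countable_nontrivialZetaZeros : nontrivialZetaZeros.Countable := by
  rw [← setOf_entireXi_eq_zero]
  have h : {s | entireXi s = 0} ⊆ ⋃ n : ℕ, {z | ‖z‖ ≤ n ∧ entireXi z = 0} := by
    intro z hz
    obtain ⟨n, hn⟩ := exists_nat_ge ‖z‖
    exact mem_iUnion.2 ⟨n, hn, hz⟩
  refine (countable_iUnion fun n : ℕ ↦ ?_).mono h
  exact (differentiable_entireXi.finite_zeros_closedBall (by simp [entireXi_zero]) n).countable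

/-- The coefficients `m(ρ) / (ρ (1 - ρ))` are absolutely summable. -/
lemma summable_norm_zero_coeff : Summable fun ρ : nontrivialZetaZeros ↦
    ‖(analyticOrderNatAt riemannZeta ρ : ℂ) * (1 / ((ρ : ℂ) * (1 - ρ)))‖ := by
  obtain ⟨C, hC, hfC⟩ := exists_norm_entireXi_le
  -- At `s = 1` the summand `1/(1-ρ) + 1/ρ` is `1/(ρ(1-ρ))`, and unconditional convergence in `ℂ` is
  -- absolute.
  have h := differentiable_entireXi.hasSum_logDeriv_sub entireXi_zero hC hfC
    (entireXi_ne_zero_of_one_le_re (s := 1) (by simp))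
  rw [setOf_entireXi_eq_zero] at h
  refine h.summable.norm.congr fun ρ ↦ ?_
  have h0 := ne_zero_of_mem_nontrivialZetaZeros ρ.2
  have h1 := one_sub_ne_zero_of_mem_nontrivialZetaZeros ρ.2
  rw [analyticOrderNatAt_entireXi ρ.2]
  congr 2
  field_simp
  ring

lemma norm_cpow_zero_le {x : ℝ} (hx : 1 < x) {ρ : ℂ} (hρ : ρ ∈ nontrivialZetaZeros) :
    ‖(x : ℂ) ^ ρ‖ ≤ x ^ (3 / 2 : ℝ) := by
  rw [Complex.norm_cpow_eq_rpow_re_of_pos (by linarith)]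
  exact Real.rpow_le_rpow_of_exponent_le hx.le (by linarith [hρ.2.1])

lemma zeroSumTerm_eq (x : ℝ) (ρ : nontrivialZetaZeros) : zeroSumTerm x ρ =
    (analyticOrderNatAt riemannZeta ρ : ℂ) * (1 / ((ρ : ℂ) * (1 - ρ))) * (x : ℂ) ^ (ρ : ℂ) := by
  rw [zeroSumTerm]
  ring

lemma norm_zeroSumTerm_le {x : ℝ} (hx : 1 < x) (ρ : nontrivialZetaZeros) : ‖zeroSumTerm x ρ‖ ≤
    ‖(analyticOrderNatAt riemannZeta ρ : ℂ) * (1 / ((ρ : ℂ) * (1 - ρ)))‖ * x ^ (3 / 2 : ℝ) := by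
  rw [zeroSumTerm_eq, norm_mul]
  gcongr
  exact norm_cpow_zero_le hx ρ.2

theorem summable_zeroSumTerm {x : ℝ} (hx : 1 < x) : Summable (zeroSumTerm x) :=
  Summable.of_norm_bounded (summable_norm_zero_coeff.mul_right _) (norm_zeroSumTerm_le hx)

/-- The contribution of the primes to the explicit formula. -/
noncomputable def primeSum (x : ℝ) : ℂ :=
  ∑' n : ℕ, (ArithmeticFunction.vonMangoldt n : ℂ) * (max (x / n - 1) 0 : ℝ)

/-- The contribution of the trivial zeros to the explicit formula. -/
noncomputable def trivialZeroSum (x : ℝ) : ℂ :=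
  ∑' n : ℕ, 1 / ((2 * (n + 1)) * (2 * (n + 1) + 1) : ℂ) * (x : ℂ) ^ (-(2 * (n + 1)) : ℂ)

lemma continuousOn_cpow_Ioi (w : ℂ) : ContinuousOn (fun x : ℝ ↦ (x : ℂ) ^ w) (Ioi 1) :=
  ContinuousOn.cpow_const Complex.continuous_ofReal.continuousOn fun _ hx ↦
    Complex.ofReal_mem_slitPlane.2 (zero_lt_one.trans hx)

lemma continuousOn_zeroSum : ContinuousOn zeroSum (Ioi 1) :=
  continuousOn_tsum_of_norm_le_rpow (u := fun ρ x ↦ zeroSumTerm x ρ)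
    (fun ρ ↦ by
      simp only [zeroSumTerm_eq]
      exact continuousOn_const.mul (continuousOn_cpow_Ioi _))
    summable_norm_zero_coeff (fun _ ↦ norm_nonneg _) fun ρ _ hx ↦ norm_zeroSumTerm_le hx ρ

lemma hasMellinIoi_zeroSum {s : ℂ} (hs : s.re = 2) : HasMellinIoi zeroSum s
    (∑' ρ : nontrivialZetaZeros, (analyticOrderNatAt riemannZeta ρ : ℂ) *
        (1 / ((ρ : ℂ) * (1 - ρ)) * (1 / (s - ρ)))) := by
  have : Countable nontrivialZetaZeros := countable_nontrivialZetaZeros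
  refine hasMellinIoi_tsum (u := fun ρ x ↦ zeroSumTerm x ρ)
    (fun ρ ↦ by
      simp only [zeroSumTerm_eq]
      exact continuousOn_const.mul (continuousOn_cpow_Ioi _))
    summable_norm_zero_coeff (fun _ ↦ norm_nonneg _) (fun ρ _ hx ↦ norm_zeroSumTerm_le hx ρ) hs
    fun ρ ↦ ?_
  simp only [zeroSumTerm_eq]
  rw [← mul_assoc]
  exact (hasMellinIoi_cpow (by rw [hs]; linarith [ρ.2.2.1])).const_mul _

lemma summable_vonMangoldt_div_rpow :
    Summable fun n : ℕ ↦ ArithmeticFunction.vonMangoldt n / (n : ℝ) ^ (3 / 2 : ℝ) := by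
  have h := (ArithmeticFunction.LSeriesSummable_vonMangoldt (s := (3 / 2 : ℝ))
    (by rw [Complex.ofReal_re]; norm_num)).norm
  refine h.congr fun n ↦ ?_
  rw [LSeries.term_def]
  rcases Nat.eq_zero_or_pos n with rfl | hn
  · simp
  · rw [if_neg hn.ne', norm_div, Complex.norm_natCast_cpow_of_pos hn, Complex.norm_real,
      Real.norm_of_nonneg ArithmeticFunction.vonMangoldt_nonneg, Complex.ofReal_re]

/-- The key bound is `max(u - 1, 0) ≤ u^(3/2)` for `u ≥ 0`, applied to `u = x / n`. -/
lemma norm_primeSum_term_le (n : ℕ) {x : ℝ} (hx : 1 < x) :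
    ‖(ArithmeticFunction.vonMangoldt n : ℂ) * (max (x / n - 1) 0 : ℝ)‖ ≤
      ArithmeticFunction.vonMangoldt n / (n : ℝ) ^ (3 / 2 : ℝ) * x ^ (3 / 2 : ℝ) := by
  have hx0 : 0 ≤ x / n := by positivity
  have hmax : max (x / n - 1) 0 ≤ (x / n) ^ (3 / 2 : ℝ) := by
    refine max_le ?_ (by positivity)
    rcases le_total (x / n) 1 with h | h
    · linarith [Real.rpow_nonneg hx0 (3 / 2)]
    · have := Real.rpow_le_rpow_of_exponent_le h (by norm_num : (1 : ℝ) ≤ 3 / 2)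
      rw [Real.rpow_one] at this
      linarith
  rw [norm_mul, Complex.norm_real, Complex.norm_real,
    Real.norm_of_nonneg ArithmeticFunction.vonMangoldt_nonneg,
    Real.norm_of_nonneg (le_max_right _ _)]
  calc ArithmeticFunction.vonMangoldt n * max (x / n - 1) 0
      ≤ ArithmeticFunction.vonMangoldt n * (x / n) ^ (3 / 2 : ℝ) := by
        gcongr
    _ = _ := by rw [Real.div_rpow (by linarith) (by positivity)]; ring

lemma continuousOn_primeSum_term (n : ℕ) : ContinuousOn (fun x : ℝ ↦
    (ArithmeticFunction.vonMangoldt n : ℂ) * (max (x / n - 1) 0 : ℝ)) (Ioi 1) := by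
  refine Continuous.continuousOn ?_
  exact continuous_const.mul (Complex.continuous_ofReal.comp
    (((continuous_id.div_const _).sub continuous_const).max continuous_const))

lemma vonMangoldt_div_rpow_nonneg (n : ℕ) :
    0 ≤ ArithmeticFunction.vonMangoldt n / (n : ℝ) ^ (3 / 2 : ℝ) :=
  div_nonneg ArithmeticFunction.vonMangoldt_nonneg (by positivity)

lemma continuousOn_primeSum : ContinuousOn primeSum (Ioi 1) :=
  continuousOn_tsum_of_norm_le_rpow continuousOn_primeSum_term summable_vonMangoldt_div_rpow
    vonMangoldt_div_rpow_nonneg fun n _ hx ↦ norm_primeSum_term_le n hx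

/-- Termwise the transform is `Λ(n) n^(-s)` times a factor independent of `n`, and these sum to the
Dirichlet series of `-ζ'/ζ`. -/
lemma hasMellinIoi_primeSum {s : ℂ} (hs : s.re = 2) : HasMellinIoi primeSum s
    (-deriv riemannZeta s / riemannZeta s * (1 / (s - 1) - 1 / s)) := by
  have h := hasMellinIoi_tsum continuousOn_primeSum_term summable_vonMangoldt_div_rpow
    vonMangoldt_div_rpow_nonneg (fun n _ hx ↦ norm_primeSum_term_le n hx) hs
    (v := fun n ↦ LSeries.term (fun n ↦ (ArithmeticFunction.vonMangoldt n : ℂ)) s n *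
      (1 / (s - 1) - 1 / s)) fun n ↦ ?_
  · rw [tsum_mul_right] at h
    rw [← ArithmeticFunction.LSeries_vonMangoldt_eq_deriv_riemannZeta_div (by linarith)]
    exact h
  · rcases eq_or_ne n 0 with rfl | hn
    · have := (hasMellinIoi_cpow (s := s) (w := 0) (by simp [hs])).const_mul 0
      rw [zero_mul] at this
      simpa using this
    · rw [LSeries.term_def, if_neg hn, div_eq_mul_inv _ ((n : ℂ) ^ s), ← Complex.cpow_neg,
        mul_assoc]
      exact (hasMellinIoi_max (by linarith) hn).const_mul _

lemma summable_norm_trivialZero_coeff :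
    Summable fun n : ℕ ↦ ‖1 / ((2 * (n + 1)) * (2 * (n + 1) + 1) : ℂ)‖ :=
  hasSum_one_div_two_mul_mul.summable.norm

lemma norm_trivialZeroSum_term_le (n : ℕ) {x : ℝ} (hx : 1 < x) :
    ‖1 / ((2 * (n + 1)) * (2 * (n + 1) + 1) : ℂ) * (x : ℂ) ^ (-(2 * (n + 1)) : ℂ)‖ ≤
      ‖1 / ((2 * (n + 1)) * (2 * (n + 1) + 1) : ℂ)‖ * x ^ (3 / 2 : ℝ) := by
  rw [norm_mul, Complex.norm_cpow_eq_rpow_re_of_pos (by linarith)]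
  refine mul_le_mul_of_nonneg_left (Real.rpow_le_rpow_of_exponent_le hx.le ?_) (norm_nonneg _)
  have := n.cast_nonneg (α := ℝ)
  simp
  linarith

lemma continuousOn_trivialZeroSum : ContinuousOn trivialZeroSum (Ioi 1) :=
  continuousOn_tsum_of_norm_le_rpow (fun _ ↦ continuousOn_const.mul (continuousOn_cpow_Ioi _))
    summable_norm_trivialZero_coeff (fun _ ↦ norm_nonneg _)
    fun n _ hx ↦ norm_trivialZeroSum_term_le n hx

lemma hasMellinIoi_trivialZeroSum {s : ℂ} (hs : s.re = 2) : HasMellinIoi trivialZeroSum s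
    (∑' n : ℕ, 1 / ((2 * (n + 1)) * (2 * (n + 1) + 1)) * (1 / (s + 2 * (n + 1)))) := by
  refine hasMellinIoi_tsum (fun _ ↦ continuousOn_const.mul (continuousOn_cpow_Ioi _))
    summable_norm_trivialZero_coeff (fun _ ↦ norm_nonneg _)
    (fun n _ hx ↦ norm_trivialZeroSum_term_le n hx) hs fun n ↦ ?_
  rw [← sub_neg_eq_add s]
  refine (hasMellinIoi_cpow ?_).const_mul _
  have := n.cast_nonneg (α := ℝ)
  simp [hs]
  linarith

/-- The explicit formula for `∑ x ^ ρ / (ρ (1 - ρ))`. -/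
theorem zeroSum_eq {x : ℝ} (hx : 1 < x) :
    zeroSum x = primeSum x - (x * Real.log x : ℝ) + (Real.eulerMascheroniConstant + 1) * x -
      Real.log (2 * Real.pi) + trivialZeroSum x := by
  rw [← sub_eq_zero]
  refine eq_zero_of_hasMellinIoi_zero (f := fun x : ℝ ↦ zeroSum x - (primeSum x -
    (x * Real.log x : ℝ) + (Real.eulerMascheroniConstant + 1) * x -
      Real.log (2 * Real.pi) + trivialZeroSum x)) ?_ (fun s hs ↦ ?_) hx
  · have hlog : ContinuousOn (fun x : ℝ ↦ ((x * Real.log x : ℝ) : ℂ)) (Ioi 1) :=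
      (Complex.continuous_ofReal.comp Real.continuous_mul_log).continuousOn
    refine continuousOn_zeroSum.sub ((((continuousOn_primeSum.sub hlog).add ?_).sub
      continuousOn_const).add continuousOn_trivialZeroSum)
    exact (continuous_const.mul Complex.continuous_ofReal).continuousOn
  · have h1 : HasMellinIoi (fun x ↦ (Real.eulerMascheroniConstant + 1) * (x : ℂ)) s
        ((Real.eulerMascheroniConstant + 1) * (1 / (s - 1))) :=
      ((hasMellinIoi_cpow (s := s) (w := 1) (by simp [hs])).const_mul _).congr fun x _ ↦ by simp
    have h2 : HasMellinIoi (fun _ ↦ (Real.log (2 * Real.pi) : ℂ)) s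
        (Real.log (2 * Real.pi) * (1 / s)) := by
      have := (hasMellinIoi_cpow (s := s) (w := 0) (by simp [hs])).const_mul
        (Real.log (2 * Real.pi) : ℂ)
      rw [sub_zero] at this
      exact this.congr fun x _ ↦ by simp
    have h := (hasMellinIoi_zeroSum hs).sub (((((hasMellinIoi_primeSum hs).sub
      (hasMellinIoi_mul_log hs)).add h1).sub h2).add (hasMellinIoi_trivialZeroSum hs))
    rw [(hasSum_zeros_div (s := s) (by linarith)).tsum_eq, sub_self] at h
    exact h

/-- The contribution of the trivial zeros in closed form. -/
lemma trivialZeroSum_eq {x : ℝ} (hx : 1 < x) :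
    trivialZeroSum x = (-(1 / 2) * Real.log (1 - (x ^ 2)⁻¹) + 1 -
      x / 2 * (Real.log (1 + x⁻¹) - Real.log (1 - x⁻¹)) : ℝ) := by
  have hx0 : 0 < x := by linarith
  have hinv : |x⁻¹| < 1 := by
    rw [abs_of_pos (inv_pos.2 hx0)]; exact inv_lt_one_of_one_lt₀ hx
  have h1 := Real.hasSum_log_sub_log_of_abs_lt_one hinv
  have hinv2 : |(x ^ 2)⁻¹| < 1 := by
    rw [abs_of_pos (by positivity)]
    exact inv_lt_one_of_one_lt₀ (one_lt_pow₀ hx two_ne_zero)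
  have h2 := Real.hasSum_pow_div_log_of_abs_lt_one hinv2
  -- Split `1/(2k(2k+1)) = 1/(2k) - 1/(2k+1)`. The second part is the odd logarithm series without
  -- its first term, which accounts for the constant `1`.
  have h3 := (hasSum_nat_add_iff' 1).2 h1
  have h4 := (h2.mul_left (1 / 2)).sub (h3.mul_left (x / 2))
  have h5 : HasSum (fun n : ℕ ↦
      1 / ((2 * (n + 1)) * (2 * (n + 1) + 1)) * ((x ^ 2)⁻¹) ^ (n + 1))
      (-(1 / 2) * Real.log (1 - (x ^ 2)⁻¹) + 1 -
      x / 2 * (Real.log (1 + x⁻¹) - Real.log (1 - x⁻¹))) := by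
    have e1 : -(1 / 2) * Real.log (1 - (x ^ 2)⁻¹) + 1 -
        x / 2 * (Real.log (1 + x⁻¹) - Real.log (1 - x⁻¹)) =
        1 / 2 * -Real.log (1 - (x ^ 2)⁻¹) - x / 2 * (Real.log (1 + x⁻¹) - Real.log (1 - x⁻¹) -
          ∑ i ∈ Finset.range 1, 2 * (1 / (2 * (i : ℝ) + 1)) * x⁻¹ ^ (2 * i + 1)) := by
      simp
      field_simp
      ring
    rw [e1]
    refine h4.congr_fun fun n ↦ ?_
    have e2 : x⁻¹ ^ (2 * (n + 1) + 1) = ((x ^ 2)⁻¹) ^ (n + 1) * x⁻¹ := by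
      rw [pow_succ, pow_mul, inv_pow]
    rw [e2]
    have : (n + 1 : ℝ) ≠ 0 := by positivity
    have : (2 * (n + 1) + 1 : ℝ) ≠ 0 := by positivity
    push_cast
    field_simp
    ring
  rw [← h5.tsum_eq, Complex.ofReal_tsum]
  refine tsum_congr fun n ↦ ?_
  have e3 : (x : ℂ) ^ (-(2 * (n + 1)) : ℂ) = ((x : ℂ) ^ 2)⁻¹ ^ (n + 1) := by
    rw [Complex.cpow_neg, inv_pow, ← pow_mul, ← Complex.cpow_natCast]
    push_cast
    rfl
  rw [e3]
  push_cast
  rfl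

end

section

open Filter Topology

/-! ### Extended Baker periods -/

section Baker

lemma extendedBakerPeriods_mul_mem {c v : ℂ} (hc : IsAlgebraic ℚ c)
    (hv : v ∈ extendedBakerPeriods) : c * v ∈ extendedBakerPeriods :=
  extendedBakerPeriods.smul_mem (⟨c, mem_algebraicClosure_iff.2 hc⟩ : algebraicClosure ℚ ℂ) hv

lemma IsAlgebraic.mem_extendedBakerPeriods {c : ℂ} (hc : IsAlgebraic ℚ c) :
    c ∈ extendedBakerPeriods := by
  simpa using extendedBakerPeriods_mul_mem hc (Submodule.subset_span (Or.inl rfl))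

lemma mem_extendedBakerPeriods_of_exp {l : ℂ} (hl : IsAlgebraic ℚ (Complex.exp l)) :
    l ∈ extendedBakerPeriods := Submodule.subset_span (Or.inr hl)

lemma IsAlgebraic.complex_ofReal {a : ℝ} (ha : IsAlgebraic ℚ a) : IsAlgebraic ℚ (a : ℂ) :=
  ha.algebraMap (A := ℂ)

lemma ofReal_log_mem_extendedBakerPeriods {a : ℝ} (h0 : 0 < a) (ha : IsAlgebraic ℚ a) :
    (Real.log a : ℂ) ∈ extendedBakerPeriods := by
  apply mem_extendedBakerPeriods_of_exp
  rw [← Complex.ofReal_exp, Real.exp_log h0]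
  exact ha.complex_ofReal

/-- Terms with `n ≥ x` vanish; the others are algebraic multiples of `0` or of the logarithm of a
prime. -/
lemma primeSum_mem_extendedBakerPeriods {x : ℝ} (hx : IsAlgebraic ℚ x) :
    primeSum x ∈ extendedBakerPeriods := by
  rw [primeSum, tsum_eq_sum (s := Finset.range (⌈x⌉₊ + 1))]
  · refine extendedBakerPeriods.sum_mem fun n _ ↦ ?_
    rw [mul_comm]
    refine extendedBakerPeriods_mul_mem ?_ ?_
    · refine IsAlgebraic.complex_ofReal ?_
      rcases max_choice (x / n - 1) 0 with h | h <;> rw [h]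
      · rw [div_eq_mul_inv]
        exact (hx.mul (isAlgebraic_natCast n).inv).sub isAlgebraic_one
      · exact isAlgebraic_zero
    · rw [ArithmeticFunction.vonMangoldt_apply]
      split_ifs with h
      · exact ofReal_log_mem_extendedBakerPeriods
          (by exact_mod_cast Nat.minFac_pos n) (isAlgebraic_natCast _)
      · simp
  · intro n hn
    have hn : ⌈x⌉₊ < n := by have := Finset.mem_range.not.1 hn; omega
    have h0 : (0 : ℝ) < n := by exact_mod_cast (Nat.zero_le _).trans_lt hn
    have : x / n - 1 ≤ 0 := by
      rw [sub_nonpos, div_le_one h0]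
      exact (Nat.le_ceil x).trans (by exact_mod_cast hn.le)
    rw [max_eq_right this]
    simp

theorem zeroSumS_mem_extendedBakerPeriods {x : ℝ} (hx : 1 < x) (ha : IsAlgebraic ℚ x) :
    zeroSumS x ∈ extendedBakerPeriods := by
  have hinv : x⁻¹ < 1 := inv_lt_one_of_one_lt₀ hx
  have hinv0 : 0 < x⁻¹ := by positivity
  have hsq : (x ^ 2)⁻¹ < 1 := inv_lt_one_of_one_lt₀ (by nlinarith)
  -- The algebraic part `x + 1` collects `x` from `(γ + 1) x` and `1` from the trivial zeros.
  have key : zeroSumS x = primeSum x + (-(x : ℂ)) * (Real.log x : ℂ) + ((x + 1 : ℝ) : ℂ)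
      + ((-(1 / 2) : ℚ) : ℂ) * (Real.log (1 - (x ^ 2)⁻¹) : ℂ)
      + (-(x / 2 : ℝ) : ℂ) * (Real.log (1 + x⁻¹) : ℂ)
      + ((x / 2 : ℝ) : ℂ) * (Real.log (1 - x⁻¹) : ℂ) := by
    rw [zeroSumS, zeroSum_eq hx, trivialZeroSum_eq hx]
    push_cast
    ring
  have h2 : IsAlgebraic ℚ (x / 2) := by
    rw [div_eq_mul_inv]
    exact ha.mul (isAlgebraic_natCast (A := ℝ) 2).inv
  rw [key]
  refine add_mem (add_mem (add_mem (add_mem (add_mem (primeSum_mem_extendedBakerPeriods ha) ?_) ?_)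
    ?_) ?_) ?_
  · exact extendedBakerPeriods_mul_mem ha.complex_ofReal.neg
      (ofReal_log_mem_extendedBakerPeriods (by linarith) ha)
  · exact (ha.add isAlgebraic_one).complex_ofReal.mem_extendedBakerPeriods
  · exact extendedBakerPeriods_mul_mem (isAlgebraic_ratCast (R := ℚ) _)
      (ofReal_log_mem_extendedBakerPeriods (by linarith) (isAlgebraic_one.sub (ha.pow 2).inv))
  · exact extendedBakerPeriods_mul_mem h2.complex_ofReal.neg
      (ofReal_log_mem_extendedBakerPeriods (by linarith) (isAlgebraic_one.add ha.inv))
  · exact extendedBakerPeriods_mul_mem h2.complex_ofReal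
      (ofReal_log_mem_extendedBakerPeriods (by linarith) (isAlgebraic_one.sub ha.inv))

end Baker

end

section

open Filter Topology

/-! ### Consequences of Schanuel's conjecture -/

section Schanuel

open scoped IntermediateField.algebraAdjoinAdjoin

lemma IntermediateField.isAlgebraic_algebraAdjoin {K E : Type*} [Field K] [Field E] [Algebra K E]
    {s : Set E} {x : E} (h : IsAlgebraic (IntermediateField.adjoin K s) x) :
    IsAlgebraic (Algebra.adjoin K s) x :=
  (IsFractionRing.isAlgebraic_iff _ (IntermediateField.adjoin K s) E).2 h

/-- The relative algebraic closure `N` of `K(s)` in `E` contains `t` and is algebraic over `K[s]`,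
so its transcendence degree is at most the cardinality of `s`. -/
lemma IntermediateField.trdeg_adjoin_le {K E : Type*} [Field K] [Field E] [Algebra K E]
    {s t : Set E} (h : ∀ y ∈ t, IsAlgebraic (IntermediateField.adjoin K s) y) :
    Algebra.trdeg K (IntermediateField.adjoin K t) ≤ Cardinal.mk s := by
  let N : IntermediateField K E :=
    (algebraicClosure (IntermediateField.adjoin K s) E).restrictScalars K
  have hN : ∀ y, y ∈ N ↔ IsAlgebraic (IntermediateField.adjoin K s) y := fun y ↦
    mem_algebraicClosure_iff
  have hsN : s ⊆ N := fun y hy ↦ (hN y).2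
    (isAlgebraic_algebraMap (⟨y, IntermediateField.subset_adjoin K s hy⟩ :
      IntermediateField.adjoin K s))
  let s' : Set N := Subtype.val ⁻¹' s
  have hmap : (Algebra.adjoin K s').map N.val = Algebra.adjoin K s := by
    rw [AlgHom.map_adjoin]
    congr 1
    ext y
    exact ⟨by rintro ⟨z, hz, rfl⟩; exact hz, fun hy ↦ ⟨⟨y, hsN hy⟩, hy, rfl⟩⟩
  -- Transports algebraicity from `K[s]` inside `E` to the same algebra formed inside `N`.
  let f : Algebra.adjoin K s' →+* Algebra.adjoin K s :=
    (N.val.comp (Algebra.adjoin K s').val).toRingHom.codRestrict (Algebra.adjoin K s) fun z ↦ by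
      rw [← hmap]
      exact ⟨z, z.2, rfl⟩
  have hf : Function.Surjective f := by
    rintro ⟨y, hy⟩
    rw [← hmap] at hy
    obtain ⟨z, hz, rfl⟩ := hy
    exact ⟨⟨z, hz⟩, rfl⟩
  have : Algebra.IsAlgebraic (Algebra.adjoin K s') N := ⟨fun z ↦
    IsAlgebraic.of_ringHom_of_comp_eq (f := f) (g := N.val.toRingHom)
      (IntermediateField.isAlgebraic_algebraAdjoin ((hN _).1 z.2)) hf N.val.injective rfl⟩
  have hle : IntermediateField.adjoin K t ≤ N :=
    IntermediateField.adjoin_le_iff.2 fun y hy ↦ (hN y).2 (h y hy)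
  calc Algebra.trdeg K (IntermediateField.adjoin K t) ≤ Algebra.trdeg K N :=
        trdeg_le_of_injective (IntermediateField.inclusion hle)
          (IntermediateField.inclusion_injective hle)
    _ ≤ Cardinal.mk s' := Algebra.IsAlgebraic.trdeg_le_cardinalMk K s'
    _ ≤ Cardinal.mk s := Cardinal.mk_preimage_of_injective Subtype.val s Subtype.val_injective

/-- The logarithms of algebraic numbers, as a vector space over `ℚ`. -/
def logsOfAlgebraic : Submodule ℚ ℂ where
  carrier := {l | IsAlgebraic ℚ (Complex.exp l)}
  add_mem' {a b} ha hb := by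
    simp only [Set.mem_ofPred_eq] at *
    rw [Complex.exp_add]
    exact ha.mul hb
  zero_mem' := by
    simp only [Set.mem_ofPred_eq, Complex.exp_zero]
    exact isAlgebraic_one
  smul_mem' q a ha := by
    simp only [Set.mem_ofPred_eq] at *
    -- The power of `exp (q a)` with exponent the denominator is an integer power of `exp a`.
    apply IsAlgebraic.of_pow q.den_pos
    rw [← Complex.exp_nat_mul]
    have : (q.den : ℂ) * (q • a) = q.num * a := by
      rw [Rat.smul_def, ← mul_assoc]
      congr 1
      exact_mod_cast Rat.den_mul_eq_num q
    rw [this, Complex.exp_int_mul]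
    rcases q.num with n | n
    · simpa using ha.pow n
    · simpa using (ha.pow (n + 1)).inv

lemma mem_logsOfAlgebraic {l : ℂ} : l ∈ logsOfAlgebraic ↔ IsAlgebraic ℚ (Complex.exp l) := Iff.rfl

/-- Under Schanuel's conjecture, there are at most `n` linearly independent numbers that are, with
their exponentials, algebraic over a field generated by `n` elements. -/
lemma SchanuelConjecture.le_of_isAlgebraic (H : SchanuelConjecture) {m : ℕ} {β : Fin m → ℂ}
    (hβ : LinearIndependent ℚ β) {s : Set ℂ} {n : ℕ} (hs : Cardinal.mk s ≤ n)
    (h1 : ∀ i, IsAlgebraic (IntermediateField.adjoin ℚ s) (β i))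
    (h2 : ∀ i, IsAlgebraic (IntermediateField.adjoin ℚ s) (Complex.exp (β i))) : m ≤ n := by
  have := (H m β hβ).trans ((IntermediateField.trdeg_adjoin_le (s := s) ?_).trans hs)
  · exact_mod_cast this
  · rintro y (⟨i, rfl⟩ | ⟨i, rfl⟩)
    exacts [h1 i, h2 i]

lemma isAlgebraic_I : IsAlgebraic ℚ Complex.I :=
  IsAlgebraic.of_pow two_pos (by rw [Complex.I_sq]; exact isAlgebraic_one.neg)

lemma isAlgebraic_pi_of_pi_mul_I {K : IntermediateField ℚ ℂ}
    (h : IsAlgebraic K (Real.pi * Complex.I : ℂ)) : IsAlgebraic K (Real.pi : ℂ) := by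
  have hI : IsAlgebraic K Complex.I := isAlgebraic_I.tower_top K
  simpa [mul_assoc] using (h.mul hI).neg

/-- Under Schanuel's conjecture, `π` is transcendental. -/
lemma SchanuelConjecture.transcendental_pi (H : SchanuelConjecture) :
    ¬ IsAlgebraic ℚ (Real.pi : ℂ) := by
  intro h
  -- If `π` were algebraic, `πi` and `exp (πi) = -1` would both be algebraic, giving `1 ≤ 0`.
  have := H.le_of_isAlgebraic (m := 1) (β := ![Real.pi * Complex.I])
    (LinearIndependent.of_subsingleton (ι := Fin 1) 0 (by simp)) (s := ∅) (n := 0) (by simp)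
    (fun i ↦ ?_) (fun i ↦ ?_)
  · simp at this
  · simpa using (h.mul isAlgebraic_I).tower_top _
  · simpa [Complex.exp_pi_mul_I] using isAlgebraic_one.neg

/-- Under Schanuel's conjecture, `log π` is not an extended Baker period. -/
theorem SchanuelConjecture.log_pi_notMem (H : SchanuelConjecture) :
    (Real.log Real.pi : ℂ) ∉ extendedBakerPeriods := by
  intro hmem
  have hexp : Complex.exp (Real.log Real.pi : ℂ) = Real.pi := by
    rw [← Complex.ofReal_exp, Real.exp_log Real.pi_pos]
  obtain ⟨T, hT, hTmem⟩ := Submodule.mem_span_finite_of_mem_span hmem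
  have hπI : (Real.pi * Complex.I : ℂ) ∈ logsOfAlgebraic := by
    rw [mem_logsOfAlgebraic, Complex.exp_pi_mul_I]
    exact isAlgebraic_one.neg
  -- The number `πi` is thrown in so that `π` itself becomes algebraic over the field `K` built from
  -- these logarithms.
  let U : Set ℂ := insert (Real.pi * Complex.I : ℂ) ((T : Set ℂ) ∩ logsOfAlgebraic)
  have hUfin : U.Finite := (T.finite_toSet.inter_of_left _).insert _
  have hUL : Submodule.span ℚ U ≤ logsOfAlgebraic :=
    Submodule.span_le.2 (Set.insert_subset hπI Set.inter_subset_right)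
  have : Module.Finite ℚ (Submodule.span ℚ U) := Module.Finite.span_of_finite ℚ hUfin
  let b := Module.finBasis ℚ (Submodule.span ℚ U)
  set n := Module.finrank ℚ (Submodule.span ℚ U)
  let α : Fin n → ℂ := fun i ↦ b i
  have hα : LinearIndependent ℚ α :=
    b.linearIndependent.map' (Submodule.span ℚ U).subtype (Submodule.ker_subtype _)
  have hspan : Submodule.span ℚ (Set.range α) = Submodule.span ℚ U := by
    have : Set.range α = (Submodule.span ℚ U).subtype '' Set.range b := by
      rw [← Set.range_comp]; rfl
    rw [this, Submodule.span_image, b.span_eq, Submodule.map_top, Submodule.range_subtype]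
  set K := IntermediateField.adjoin ℚ (Set.range α)
  have hK : ∀ y ∈ Submodule.span ℚ U, y ∈ K := by
    rw [← hspan]
    exact fun y hy ↦ Submodule.span_le (p := Subalgebra.toSubmodule K.toSubalgebra)|>.2
      (IntermediateField.subset_adjoin ℚ (Set.range α)) hy
  have hKalg : ∀ y ∈ K, IsAlgebraic K y := fun y hy ↦ isAlgebraic_algebraMap (⟨y, hy⟩ : K)
  have hspanK : ∀ y ∈ Submodule.span (algebraicClosure ℚ ℂ) (T : Set ℂ), IsAlgebraic K y := by
    intro y hy
    induction hy using Submodule.span_induction with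
    | mem y hy =>
      rcases hT hy with rfl | hy'
      · exact isAlgebraic_one
      · exact hKalg y (hK y (Submodule.subset_span (Or.inr ⟨hy, hy'⟩)))
    | zero => exact isAlgebraic_zero
    | add y z _ _ hy hz => exact hy.add hz
    | smul a y _ hy =>
      exact ((mem_algebraicClosure_iff.1 a.2).tower_top K).mul hy
  have hpi : IsAlgebraic K (Real.pi : ℂ) :=
    isAlgebraic_pi_of_pi_mul_I (hKalg _ (hK _ (Submodule.subset_span (Or.inl rfl))))
  have hαL : ∀ i, α i ∈ logsOfAlgebraic := fun i ↦ hUL (b i).2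
  -- If `log π` is a rational combination of logarithms of algebraic numbers, then `π` is algebraic.
  -- Otherwise it extends the basis to `n + 1` independent numbers which, with their exponentials,
  -- are algebraic over `K`.
  by_cases hind : (Real.log Real.pi : ℂ) ∈ Submodule.span ℚ (Set.range α)
  · refine H.transcendental_pi ?_
    rw [← hexp]
    exact hUL (hspan ▸ hind)
  · have := H.le_of_isAlgebraic (m := n + 1) (β := Fin.cons (Real.log Real.pi : ℂ) α)
      (linearIndependent_finCons.2 ⟨hα, hind⟩) (s := Set.range α) (n := n)
      (by simpa using Cardinal.mk_range_le (f := α)) (fun i ↦ ?_) (fun i ↦ ?_)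
    · omega
    · refine Fin.cases ?_ (fun j ↦ ?_) i
      · exact hspanK _ hTmem
      · exact hKalg _ (IntermediateField.subset_adjoin ℚ _ ⟨j, rfl⟩)
    · refine Fin.cases ?_ (fun j ↦ ?_) i
      · simpa only [Fin.cons_zero, hexp] using hpi
      · exact (hαL j).tower_top K

end Schanuel

end

/-! ### The main theorem. -/

theorem mainTheorem7 :
    (∀ x : ℝ, 1 < x → Summable (zeroSumTerm x)) ∧
    (∀ x : ℝ, 1 < x → IsAlgebraic ℚ x → zeroSumS x ∈ extendedBakerPeriods) ∧
    (SchanuelConjecture →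
      ({v : ℂ | ∃ x : ℝ, 1 < x ∧ IsAlgebraic ℚ x ∧ v = zeroSum x} ∩
        {v : ℂ | IsAlgebraic ℚ v}).Subsingleton) := by
  refine ⟨fun x hx ↦ summable_zeroSumTerm hx,
    fun x hx ha ↦ zeroSumS_mem_extendedBakerPeriods hx ha, ?_⟩
  rintro H _ ⟨⟨x, hx, hxa, rfl⟩, hFx⟩ _ ⟨⟨y, hy, hya, rfl⟩, hFy⟩
  by_contra hne
  have hxy : (y : ℂ) - x ≠ 0 := by
    rw [sub_ne_zero]
    rintro h
    exact hne (by rw [Complex.ofReal_injective h])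
  have hxa' := hxa.complex_ofReal
  have hya' := hya.complex_ofReal
  -- In `y S(x) - x S(y)` Euler's constant cancels and `log 2π` survives with coefficient `y - x ≠
  -- 0`.
  have key : (Real.log Real.pi : ℂ) = ((y : ℂ) - x)⁻¹ *
      (y * zeroSumS x - x * zeroSumS y - (y * zeroSum x - x * zeroSum y)) - Real.log 2 := by
    have h2 : Real.log (2 * Real.pi) = Real.log 2 + Real.log Real.pi :=
      Real.log_mul two_ne_zero Real.pi_ne_zero
    rw [zeroSumS, zeroSumS, h2, eq_sub_iff_add_eq, eq_inv_mul_iff_mul_eq₀ hxy]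
    push_cast
    ring
  refine H.log_pi_notMem ?_
  rw [key]
  refine sub_mem (extendedBakerPeriods_mul_mem (hya'.sub hxa').inv (sub_mem (sub_mem ?_ ?_) ?_))
    (ofReal_log_mem_extendedBakerPeriods two_pos (isAlgebraic_natCast 2))
  · exact extendedBakerPeriods_mul_mem hya' (zeroSumS_mem_extendedBakerPeriods hx hxa)
  · exact extendedBakerPeriods_mul_mem hxa' (zeroSumS_mem_extendedBakerPeriods hy hya)
  · exact ((hya'.mul hFx).sub (hxa'.mul hFy)).mem_extendedBakerPeriods
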